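/- Let $L:\mathbb R^p\to\mathbb R$ be continuously differentiable with gradient $g$, and let $\theta^*$ be a minimizer of $L$. Let $a_k,c_k$ be real numbers and, on a probability space, let $\hat\theta_0,\pi_k\in\mathbb R^p$ and $\varepsilon_k^{(\pm)}\in\mathbb R$ $(k\ge 0)$ be random; the iterates of random-direction stochastic approximation (RDSA) are $$\hat\theta_{k+1}=\hat\theta_k-a_k\,\frac{y_k^{(+)}-y_k^{(-)}}{2c_k}\,\pi_k,\qquad y_k^{(\pm)}=L(\hat\theta_k\pm c_k\pi_k)+\varepsilon_k^{(\pm)} .$$ Let $K\in\mathbb N$ and let $\alpha_0,\alpha_1,\alpha_2$ be constants. Suppose that for every $k\ge K$: * the components $\pi_{k1},\dots,\pi_{kp}$ of $\pi_k$ are i.i.d. $N(0,1)$, and $\pi_k$ is independent of $(\hat\theta_0,\dots,\hat\theta_k,\varepsilon_k^{(+)},\varepsilon_k^{(-)})$; * $\varepsilon_k^{(+)}$ and $\varepsilon_k^{(-)}$ have mean $0$, and the pair $(\varepsilon_k^{(+)},\varepsilon_k^{(-)})$ is independent of $(\hat\theta_k,\pi_k)$; * almost surely, on some open neighbourhood of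 $\hat\theta_k$ the third derivative of $L$ exists and is continuous, with $|L'''_{ijl}|\le\alpha_2$ for all $i,j,l$. Suppose further: * **A1.** $a_k>0$, $c_k>0$ for all $k$, $a_k\to0$, $c_k\to0$, $\sum_k a_k=\infty$, $\sum_k (a_k/c_k)^2<\infty$. * **A2.** $\sup_k\|\hat\theta_k\|<\infty$ almost surely. * **A3.** $\theta^*$ is an asymptotically stable (in the sense of Lyapunov) equilibrium of the differential equation $dx/dt=-g(x)$. * **A4.** There is a compact set $S\subseteq D(\theta^*)$ such that, almost surely, $\hat\theta_k\in S$ for infinitely many $k$. Here $D(\theta^*)$ is the set of the points $x_0$ from which $dx/dt=-g(x)$, $x(0)=x_0$, has a solution on $[0,\infty)$ and all such solutions tend to $\theta^*$ as $t\to\infty$. * **A5.** For every $k\ge K$: $E|\varepsilon_k^{(\pm)}|^2\le\alpha_0$, $E(\pi_k\pi_k^T)=I$, and $E\big[\pi_{kl}^2\,L(\hat\theta_k\pm c_k\pi_k)^2\big]\le\alpha_1$ for $l=1,\dots,p$. Then $\hat\theta_k\to\theta^*$ as $k\to\infty$, almost surely. -/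

import Mathlib

open MeasureTheory ProbabilityTheory Filter Topology Set

/-- The random-direction estimate of the gradient of `L` at `θ`, with difference magnitude `c`,
direction `v`, and noise `ep`, `em` in the measurements of `L (θ + c v)` and `L (θ - c v)`. -/
noncomputable def rdsaGradEst {p : ℕ} (L : EuclideanSpace ℝ (Fin p) → ℝ) (c : ℝ)
    (v : EuclideanSpace ℝ (Fin p)) (ep em : ℝ) (θ : EuclideanSpace ℝ (Fin p)) :
    EuclideanSpace ℝ (Fin p) :=
  (((L (θ + c • v) + ep) - (L (θ - c • v) + em)) / (2 * c)) • v

/-- The random-direction stochastic approximation iterates: start at `θ₀` and at step `k` move by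
`- a k` times the gradient estimate with direction `π k` and noise `εp k`, `εm k`. -/
noncomputable def rdsaIterate {p : ℕ} {Ω : Type*} (L : EuclideanSpace ℝ (Fin p) → ℝ)
    (a c : ℕ → ℝ) (π : ℕ → Ω → EuclideanSpace ℝ (Fin p)) (εp εm : ℕ → Ω → ℝ)
    (θ₀ : Ω → EuclideanSpace ℝ (Fin p)) : ℕ → Ω → EuclideanSpace ℝ (Fin p)
  | 0, ω => θ₀ ω
  | k + 1, ω => rdsaIterate L a c π εp εm θ₀ k ω -
      a k • rdsaGradEst L (c k) (π k ω) (εp k ω) (εm k ω) (rdsaIterate L a c π εp εm θ₀ k ω)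

/-- `x` solves the differential equation `dx/dt = - g(x)`, `g` the gradient of `L`, on `I`. -/
def IsGradientFlowOn {p : ℕ} (L : EuclideanSpace ℝ (Fin p) → ℝ)
    (x : ℝ → EuclideanSpace ℝ (Fin p)) (I : Set ℝ) : Prop :=
  IsIntegralCurveOn x (fun _ y => -gradient L y) I

/-- The domain of attraction of `θs`: the initial points `x₀` from which the solution of
`dx/dt = - g(x)` exists for all times `t ≥ 0` and tends to `θs`. (Where solutions are not unique,
every solution has to tend to `θs`.) -/
def domainOfAttraction {p : ℕ} (L : EuclideanSpace ℝ (Fin p) → ℝ)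
    (θs : EuclideanSpace ℝ (Fin p)) : Set (EuclideanSpace ℝ (Fin p)) :=
  {x₀ | (∃ x, IsGradientFlowOn L x (Ici 0) ∧ x 0 = x₀) ∧
    ∀ x, IsGradientFlowOn L x (Ici 0) → x 0 = x₀ → Tendsto x atTop (𝓝 θs)}

/-- `θs` is an asymptotically stable stationary solution (in the sense of Lyapunov) of
`dx/dt = - g(x)`: it is an equilibrium, it is stable, and it attracts all nearby solutions. -/
structure IsAsymptoticallyStable {p : ℕ} (L : EuclideanSpace ℝ (Fin p) → ℝ)
    (θs : EuclideanSpace ℝ (Fin p)) : Prop where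
  equilibrium : gradient L θs = 0
  stable : ∀ ε > 0, ∃ δ > 0, ∀ (T : ℝ) (x : ℝ → EuclideanSpace ℝ (Fin p)),
    IsGradientFlowOn L x (Ico 0 T) → ‖x 0 - θs‖ < δ → ∀ t ∈ Ico 0 T, ‖x t - θs‖ < ε
  attractive : domainOfAttraction L θs ∈ 𝓝 θs

/-!
The proof is the ODE method for a vector field that is continuous but need not be Lipschitz, so that
the solutions of the differential equation need not be unique.

*Noise.* The direction of a step is independent of the past and of the noise of the step, and has
mean zero. Given the past, the mean of the gradient estimate at scale `c` is therefore the average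
of the smoothed gradients `gaussianSmoothedGradient` at the scales `c` and `-c`
(`condExp_rdsaGradEst`). Its second moment is of order `c⁻²` (`memLp_rdsaGradEst`), so that with
`∑ (a k / c k)² < ∞` the deviations from the conditional means, multiplied by `a k`, are the
increments of an `L²`-bounded martingale. Their sum converges almost surely
(`ae_exists_tendsto_sum_sub_condExp`).

*Bias.* The smoothed gradient tends to the gradient as the scale tends to `0`, uniformly on bounded
sets (`exists_gaussian_smoothing_sub_gradient_le`). There is no growth condition on `L`, and the far
values of `L` are controlled as follows: by Fubini's theorem, the moment bound of one single step
gives one center and one scale for which `L` has a finite Gaussian-weighted second moment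
(`exists_integrable_sq_stdGaussian`), and the Gaussian densities of much smaller scale with bounded
center are, away from their center, negligible compared to that one (`exists_gaussian_tail_le`).

*Limit dynamics.* Almost every path is thus a perturbed Euler scheme for `x' = -∇L(x)`, once the
iterates are shifted by the tails of the convergent noise sum. By compactness, limits of the scheme
along an ultrafilter of starting indices are solutions on `[0, ∞)`
(`exists_integralCurve_of_ultrafilter`). Started from a cluster point in `S`, such a solution tends
to `θs`, and so `θs` is a cluster point of the scheme. If the scheme nevertheless left a
neighbourhood of `θs` infinitely often, the limit of its upcrossings would be a solution that starts
close to `θs` and leaves the neighbourhood in finite time, against stability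
(`tendsto_of_euler_of_stable`).
-/

/-! ### Perturbed Euler schemes and their limits -/

section PerturbedEuler

variable {E : Type*} [NormedAddCommGroup E] [NormedSpace ℝ E]

/-- Between two indices a recursion `x (k + 1) = x k - a k • h k` follows the constant velocity `-v`
up to the deviation of the `h k` from `v`, in the time scale given by the partial sums of `a`. -/
lemma norm_euler_sub_le {x h : ℕ → E} {a : ℕ → ℝ} (ha : ∀ k, 0 < a k) {i j : ℕ} (hij : i ≤ j)
    (hrec : ∀ k, i ≤ k → x (k + 1) = x k - a k • h k) {v : E} {η : ℝ}
    (hv : ∀ k, i ≤ k → k < j → ‖h k - v‖ ≤ η) :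
    ‖x j - x i + (∑ k ∈ Finset.range j, a k - ∑ k ∈ Finset.range i, a k) • v‖ ≤
      η * (∑ k ∈ Finset.range j, a k - ∑ k ∈ Finset.range i, a k) := by
  induction j, hij using Nat.le_induction with
  | base => simp
  | succ j hij ih =>
    have h1 := ih fun k hk hkj => hv k hk (by omega)
    have h2 := hv j hij (by omega)
    rw [Finset.sum_range_succ, hrec j hij]
    have e : x j - a j • h j - x i +
        (∑ k ∈ Finset.range j, a k + a j - ∑ k ∈ Finset.range i, a k) • v =
        (x j - x i + (∑ k ∈ Finset.range j, a k - ∑ k ∈ Finset.range i, a k) • v)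
          - a j • (h j - v) := by module
    rw [e]
    refine (norm_sub_le _ _).trans ?_
    rw [norm_smul, Real.norm_of_nonneg (ha j).le]
    nlinarith [mul_le_mul_of_nonneg_left h2 (ha j).le]

lemma monotone_sum_range {a : ℕ → ℝ} (ha : ∀ k, 0 < a k) :
    Monotone fun n => ∑ k ∈ Finset.range n, a k :=
  monotone_nat_of_le_succ fun n => by
    rw [Finset.sum_range_succ]; linarith [ha n]

lemma norm_euler_sub_le_of_bound {x h : ℕ → E} {a : ℕ → ℝ} (ha : ∀ k, 0 < a k) {N : ℕ} {C : ℝ}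
    (hrec : ∀ k, N ≤ k → x (k + 1) = x k - a k • h k) (hC : ∀ k, N ≤ k → ‖h k‖ ≤ C)
    {i j : ℕ} (hi : N ≤ i) (hj : N ≤ j) :
    ‖x j - x i‖ ≤ C * |∑ k ∈ Finset.range j, a k - ∑ k ∈ Finset.range i, a k| := by
  wlog hij : i ≤ j generalizing i j
  · rw [norm_sub_rev, abs_sub_comm]
    exact this hj hi (by omega)
  have := norm_euler_sub_le (v := 0) (η := C) ha hij (fun k hk => hrec k (hi.trans hk))
    fun k hk _ => by simpa using hC k (hi.trans hk)
  rw [abs_of_nonneg (sub_nonneg.2 (monotone_sum_range ha hij))]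
  simpa using this

/-- The version of `norm_euler_sub_le` for indices in either order. -/
lemma norm_euler_sub_le_abs {x h : ℕ → E} {a : ℕ → ℝ} (ha : ∀ k, 0 < a k) {i j N : ℕ}
    (hi : N ≤ i) (hj : N ≤ j)
    (hrec : ∀ k, N ≤ k → x (k + 1) = x k - a k • h k) {v : E} {η : ℝ}
    (hv : ∀ k, min i j ≤ k → k < max i j → ‖h k - v‖ ≤ η) :
    ‖x j - x i + (∑ k ∈ Finset.range j, a k - ∑ k ∈ Finset.range i, a k) • v‖ ≤
      η * |∑ k ∈ Finset.range j, a k - ∑ k ∈ Finset.range i, a k| := by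
  wlog hij : i ≤ j generalizing i j
  · have := this hj hi (by simpa [min_comm, max_comm] using hv) (by omega)
    rw [abs_sub_comm, ← norm_neg]
    refine le_of_eq_of_le (congrArg norm ?_) this
    module
  rw [abs_of_nonneg (sub_nonneg.2 (monotone_sum_range ha hij))]
  exact norm_euler_sub_le ha hij (fun k hk => hrec k (hi.trans hk)) fun k hk hkj =>
    hv k (by simpa [hij] using hk) (by simpa [hij] using hkj)

/-- As the steps tend to `0` and sum up to `∞`, there is, starting from any index `n`, an index
reached after a time that is asymptotically `t`. -/
lemma exists_index_at_time {a : ℕ → ℝ} (ha : ∀ k, 0 < a k) (ha_lim : Tendsto a atTop (𝓝 0))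
    (ha_sum : Tendsto (fun n => ∑ k ∈ Finset.range n, a k) atTop atTop) {t : ℝ} (ht : 0 ≤ t) :
    ∃ m : ℕ → ℕ, (∀ n, n ≤ m n) ∧
      Tendsto (fun n => ∑ k ∈ Finset.range (m n), a k - ∑ k ∈ Finset.range n, a k) atTop (𝓝 t) := by
  set τ : ℕ → ℝ := fun n => ∑ k ∈ Finset.range n, a k with hτ
  have hex : ∀ n, ∃ j, τ n + t < τ (j + 1) := fun n => by
    obtain ⟨j, hj⟩ :=
      (((tendsto_add_atTop_iff_nat 1).2 ha_sum).eventually_gt_atTop (τ n + t)).exists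
    exact ⟨j, hj⟩
  have hle : ∀ n, n ≤ Nat.find (hex n) := fun n => by
    by_contra! hlt
    have h1 := Nat.find_spec (hex n)
    have h2 : τ (Nat.find (hex n) + 1) ≤ τ n := monotone_sum_range ha hlt
    linarith
  refine ⟨fun n => Nat.find (hex n), hle, ?_⟩
  have hup : ∀ n, τ (Nat.find (hex n)) ≤ τ n + t := fun n => by
    rcases Nat.eq_zero_or_pos (Nat.find (hex n)) with h0 | h0
    · have : n = 0 := by have := hle n; omega
      rw [h0, this]; linarith
    · have := Nat.find_min (hex n) (m := Nat.find (hex n) - 1) (by omega)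
      rw [Nat.sub_add_cancel h0] at this
      exact not_lt.1 this
  have hlow : ∀ n, t - a (Nat.find (hex n)) ≤ τ (Nat.find (hex n)) - τ n := fun n => by
    have h1 := Nat.find_spec (hex n)
    simp only [hτ, Finset.sum_range_succ] at h1 ⊢
    linarith
  have hm : Tendsto (fun n => Nat.find (hex n)) atTop atTop := tendsto_atTop_mono hle tendsto_id
  refine tendsto_of_tendsto_of_tendsto_of_le_of_le (g := fun n => t - a (Nat.find (hex n)))
    (h := fun _ => t) ?_ tendsto_const_nhds hlow fun n => ?_
  · simpa using tendsto_const_nhds.sub (ha_lim.comp hm)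
  · have := hup n
    simp only [hτ] at this ⊢
    linarith

/-- Limits of a perturbed Euler scheme solve the differential equation. Along an ultrafilter, all
the iterates at asymptotic time `t` after the index `n` have the same limit `y t`, and `y` is a
solution of `y' = -g(y)` on `[0, ∞)`. The ultrafilter takes the place of the subsequences of the
Arzelà–Ascoli theorem. -/
lemma exists_integralCurve_of_ultrafilter [ProperSpace E] {g : E → E} (hg : Continuous g)
    {x h : ℕ → E} {a : ℕ → ℝ} (ha : ∀ k, 0 < a k) (ha_lim : Tendsto a atTop (𝓝 0))
    (ha_sum : Tendsto (fun n => ∑ k ∈ Finset.range n, a k) atTop atTop) {N : ℕ}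
    (hrec : ∀ k, N ≤ k → x (k + 1) = x k - a k • h k) {B : ℝ} (hB : ∀ k, ‖x k‖ ≤ B)
    (hh : Tendsto (fun k => h k - g (x k)) atTop (𝓝 0)) (U : Ultrafilter ℕ)
    (hU : (U : Filter ℕ) ≤ atTop) :
    ∃ y : ℝ → E, IsIntegralCurveOn y (fun _ z => -g z) (Ici 0) ∧
      ∀ (m : ℕ → ℕ) (t : ℝ), 0 ≤ t → (∀ᶠ n in U, n ≤ m n) →
        Tendsto (fun n => ∑ k ∈ Finset.range (m n), a k - ∑ k ∈ Finset.range n, a k) U (𝓝 t) →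
        Tendsto (fun n => x (m n)) U (𝓝 (y t)) := by
  set τ : ℕ → ℝ := fun n => ∑ k ∈ Finset.range n, a k with hτ
  have hτm : Monotone τ := monotone_sum_range ha
  -- a bound for the `h k`, hence a Lipschitz bound in the time scale `τ`
  obtain ⟨G, hG⟩ : ∃ G, ∀ z ∈ Metric.closedBall (0 : E) B, ‖g z‖ ≤ G :=
    (isCompact_closedBall 0 B).exists_bound_of_continuousOn hg.continuousOn
  obtain ⟨N₁, hN₁⟩ : ∃ N₁, ∀ k, N₁ ≤ k → N ≤ k ∧ ‖h k‖ ≤ G + 1 := by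
    have h1 : ∀ᶠ k in atTop, ‖h k - g (x k)‖ < 1 := by
      simpa using hh.norm.eventually_lt_const (u := 1) (by simp)
    obtain ⟨N₁, hN₁⟩ := eventually_atTop.1 (h1.and (eventually_ge_atTop N))
    refine ⟨N₁, fun k hk => ⟨(hN₁ k hk).2, ?_⟩⟩
    have h2 := hG (x k) (by simpa using hB k)
    have h3 := norm_add_le (h k - g (x k)) (g (x k))
    rw [sub_add_cancel] at h3
    linarith [(hN₁ k hk).1]
  have hG1 : 0 ≤ G + 1 := (norm_nonneg _).trans (hN₁ N₁ le_rfl).2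
  have hlip : ∀ i j, N₁ ≤ i → N₁ ≤ j → ‖x j - x i‖ ≤ (G + 1) * |τ j - τ i| := fun i j hi hj =>
    norm_euler_sub_le_of_bound ha (fun k hk => hrec k (hN₁ k hk).1) (fun k hk => (hN₁ k hk).2) hi hj
  -- for each time a choice of indices and the limit along the ultrafilter
  have hm : ∀ t : ℝ, ∃ m : ℕ → ℕ, 0 ≤ t → (∀ n, n ≤ m n) ∧
      Tendsto (fun n => τ (m n) - τ n) atTop (𝓝 t) := fun t => by
    by_cases ht : 0 ≤ t
    · obtain ⟨m, h1, h2⟩ := exists_index_at_time ha ha_lim ha_sum ht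
      exact ⟨m, fun _ => ⟨h1, h2⟩⟩
    · exact ⟨id, fun h => absurd h ht⟩
  choose m hm using hm
  have hlim : ∀ t : ℝ, ∃ y, Tendsto (fun n => x (m t n)) U (𝓝 y) := fun t => by
    obtain ⟨y, -, hy⟩ := (isCompact_closedBall (0 : E) B).ultrafilter_le_nhds
      (U.map fun n => x (m t n)) (by
        rw [le_principal_iff]
        exact Ultrafilter.mem_map.2 (univ_mem' fun n => by simpa using hB (m t n)))
    exact ⟨y, hy⟩
  choose y hy using hlim
  have hUN : ∀ᶠ n in U, N₁ ≤ n := hU (eventually_ge_atTop N₁)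
  refine ⟨y, ?_, ?_⟩
  · intro t ht
    rw [mem_Ici] at ht
    rw [hasDerivWithinAt_iff_isLittleO, Asymptotics.isLittleO_iff]
    intro η hη
    obtain ⟨δ, hδ, hgδ⟩ := Metric.continuousAt_iff.1 (hg.continuousAt (x := y t)) (η / 2)
      (by linarith)
    have hG2 : 0 < G + 2 := by linarith
    have hδ' : 0 < δ / (3 * (G + 2)) := by positivity
    filter_upwards [self_mem_nhdsWithin, mem_nhdsWithin_of_mem_nhds (Metric.ball_mem_nhds t hδ')]
      with s hs hst
    rw [mem_Ici] at hs
    rw [Metric.mem_ball, Real.dist_eq] at hst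
    have hTt := (hm t ht).2.mono_left hU
    have hTs := (hm s hs).2.mono_left hU
    have hTd : Tendsto (fun n => τ (m s n) - τ (m t n)) U (𝓝 (s - t)) := by
      refine (hTs.sub hTt).congr fun n => by ring
    have hL : Tendsto (fun n => ‖x (m s n) - x (m t n) + (τ (m s n) - τ (m t n)) • g (y t)‖) U
        (𝓝 ‖y s - y t + (s - t) • g (y t)‖) :=
      (((hy s).sub (hy t)).add (hTd.smul_const _)).norm
    have hR : Tendsto (fun n => η * |τ (m s n) - τ (m t n)|) U (𝓝 (η * |s - t|)) :=
      (hTd.abs).const_mul _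
    have hgoal : ‖y s - y t + (s - t) • g (y t)‖ ≤ η * |s - t| := by
      refine le_of_tendsto_of_tendsto hL hR ?_
      have e1 : ∀ᶠ n in U, |τ (m s n) - τ (m t n)| < δ / (3 * (G + 2)) :=
        hTd.abs.eventually_lt_const hst
      have e2 : ∀ᶠ n in U, dist (x (m t n)) (y t) < δ / 3 :=
        (hy t).eventually (Metric.ball_mem_nhds _ (by positivity))
      have e3 : ∀ᶠ n in U, ∀ k, n ≤ k → ‖h k - g (x k)‖ < η / 2 := by
        have : ∀ᶠ k in atTop, ‖h k - g (x k)‖ < η / 2 := by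
          simpa using hh.norm.eventually_lt_const (u := η / 2) (by simpa using hη)
        exact hU (eventually_forall_ge_atTop.2 this)
      filter_upwards [e1, e2, e3, hUN] with n h1 h2 h3 h4
      have hn1 := (hm t ht).1 n
      have hn2 := (hm s hs).1 n
      refine norm_euler_sub_le_abs (N := N₁) ha (h4.trans hn1) (h4.trans hn2)
        (fun k hk => hrec k (hN₁ k hk).1) fun k hk1 hk2 => ?_
      have hnk : n ≤ k := (le_min hn1 hn2).trans hk1
      have h5 : |τ k - τ (m t n)| ≤ |τ (m s n) - τ (m t n)| := by
        rcases le_total (m t n) (m s n) with hc | hc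
        · rw [min_eq_left hc] at hk1
          rw [max_eq_right hc] at hk2
          rw [abs_of_nonneg (sub_nonneg.2 (hτm hk1)), abs_of_nonneg (sub_nonneg.2 (hτm hc))]
          linarith [hτm hk2.le]
        · rw [min_eq_right hc] at hk1
          rw [max_eq_left hc] at hk2
          rw [abs_of_nonpos (sub_nonpos.2 (hτm hk2.le)), abs_of_nonpos (sub_nonpos.2 (hτm hc))]
          linarith [hτm hk1]
      have h6 : ‖x k - x (m t n)‖ ≤ δ / 3 := by
        refine (hlip _ _ (h4.trans hn1) (h4.trans hnk)).trans ?_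
        calc (G + 1) * |τ k - τ (m t n)| ≤ (G + 2) * (δ / (3 * (G + 2))) :=
              mul_le_mul (by linarith) (h5.trans h1.le) (abs_nonneg _) (by linarith)
          _ = δ / 3 := by field_simp
      have h7 : dist (x k) (y t) < δ := by
        calc dist (x k) (y t) ≤ dist (x k) (x (m t n)) + dist (x (m t n)) (y t) :=
              dist_triangle _ _ _
          _ < δ := by rw [dist_eq_norm (x k)]; linarith
      have h8 := hgδ h7
      rw [dist_eq_norm] at h8
      calc ‖h k - g (y t)‖ ≤ ‖h k - g (x k)‖ + ‖g (x k) - g (y t)‖ :=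
            norm_sub_le_norm_sub_add_norm_sub _ _ _
        _ ≤ η := by linarith [h3 k hnk]
    simpa [Real.norm_eq_abs, sub_eq_add_neg] using hgoal
  · intro m' t ht hm'n hm't
    have hTt := (hm t ht).2.mono_left hU
    have hd : Tendsto (fun n => (G + 1) * |τ (m' n) - τ (m t n)|) U (𝓝 0) := by
      have : Tendsto (fun n => τ (m' n) - τ (m t n)) U (𝓝 0) := by
        have := hm't.sub hTt
        rw [sub_self] at this
        exact this.congr fun n => by simp only [hτ]; ring
      simpa using this.abs.const_mul (G + 1)
    have h0 : Tendsto (fun n => x (m' n) - x (m t n)) U (𝓝 0) := by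
      refine squeeze_zero_norm' ?_ hd
      filter_upwards [hUN, hm'n] with n h4 h5
      exact hlip _ _ (h4.trans ((hm t ht).1 n)) (h4.trans h5)
    simpa using h0.add (hy t)

/-- If a perturbed Euler scheme has a cluster point whose solutions of the differential equation
all tend to `z`, and `z` is stable and attractive, then the scheme converges to `z`. -/
lemma tendsto_of_euler_of_stable [ProperSpace E] {g : E → E} (hg : Continuous g)
    {x h : ℕ → E} {a : ℕ → ℝ} (ha : ∀ k, 0 < a k) (ha_lim : Tendsto a atTop (𝓝 0))
    (ha_sum : Tendsto (fun n => ∑ k ∈ Finset.range n, a k) atTop atTop) {N : ℕ}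
    (hrec : ∀ k, N ≤ k → x (k + 1) = x k - a k • h k) {B : ℝ} (hB : ∀ k, ‖x k‖ ≤ B)
    (hh : Tendsto (fun k => h k - g (x k)) atTop (𝓝 0)) {z : E} {D : Set E}
    (hD : ∀ y : ℝ → E, IsIntegralCurveOn y (fun _ z => -g z) (Ici 0) → y 0 ∈ D →
      Tendsto y atTop (𝓝 z)) (hDz : D ∈ 𝓝 z)
    (hstable : ∀ ε > 0, ∃ δ > 0, ∀ y : ℝ → E, IsIntegralCurveOn y (fun _ z => -g z) (Ici 0) →
      ‖y 0 - z‖ < δ → ∀ t, 0 ≤ t → ‖y t - z‖ < ε)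
    {s : E} (hs : s ∈ D) (hclus : MapClusterPt s atTop x) :
    Tendsto x atTop (𝓝 z) := by
  have hmain := exists_integralCurve_of_ultrafilter hg ha ha_lim ha_sum hrec hB hh
  have hzero : ∀ U : Filter ℕ, Tendsto (fun n => ∑ k ∈ Finset.range n, a k -
      ∑ k ∈ Finset.range n, a k) U (𝓝 0) := fun U => by
    simpa using tendsto_const_nhds
  -- the iterates come close to `z` again and again
  have hfreq : ∀ r > 0, ∃ᶠ n in atTop, ‖x n - z‖ < r := by
    intro r hr
    obtain ⟨U, hU, hUs⟩ := mapClusterPt_iff_ultrafilter.1 hclus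
    obtain ⟨y, hy, hyl⟩ := hmain U hU
    have hy0 : y 0 = s :=
      tendsto_nhds_unique (hyl id 0 le_rfl (Eventually.of_forall fun n => le_rfl) (hzero _)) hUs
    have hyz := hD y hy (hy0 ▸ hs)
    obtain ⟨T, hT, hT0⟩ := ((hyz.eventually (Metric.ball_mem_nhds z hr)).and
      (eventually_ge_atTop 0)).exists
    obtain ⟨m, hm1, hm2⟩ := exists_index_at_time ha ha_lim ha_sum hT0
    have h1 := hyl m T hT0 (Eventually.of_forall hm1) (hm2.mono_left hU)
    have h2 : ∀ᶠ n in U, ‖x (m n) - z‖ < r := by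
      filter_upwards [h1.eventually (Metric.isOpen_ball.mem_nhds hT)] with n hn
      simpa [dist_eq_norm] using hn
    have h3 : Tendsto m U atTop := tendsto_atTop_mono hm1 hU
    exact h3.frequently h2.frequently
  rw [Metric.tendsto_atTop']
  by_contra hcon
  push Not at hcon
  obtain ⟨ε, hε, hcon⟩ := hcon
  obtain ⟨δ, hδ, hst⟩ := hstable ε hε
  obtain ⟨ρ, hρ, hρD⟩ := Metric.mem_nhds_iff.1 hDz
  obtain ⟨r, hr, hrm⟩ := exists_between (lt_min hε (lt_min hδ hρ))
  rw [lt_min_iff, lt_min_iff] at hrm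
  -- an upcrossing: `n` is the last index in the small ball before the index `m`, at which the
  -- iterate is outside of the large ball
  set P : ℕ → ℕ → Prop := fun n m => n ≤ m ∧ ‖x n - z‖ < r ∧ ε ≤ ‖x m - z‖ ∧
    ∀ k, n < k → k ≤ m → r ≤ ‖x k - z‖ with hP
  have hup : ∃ᶠ n in atTop, ∃ m, P n m := by
    rw [frequently_atTop]
    intro M
    obtain ⟨n₀, hn₀, hn₀r⟩ := frequently_atTop.1 (hfreq r hr) M
    obtain ⟨m, hm, hmε⟩ := hcon n₀
    classical
    have hspec := Nat.findGreatest_spec (P := fun n => ‖x n - z‖ < r) hm.le hn₀r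
    refine ⟨Nat.findGreatest (fun n => ‖x n - z‖ < r) m,
      hn₀.trans (Nat.le_findGreatest hm.le hn₀r), m, Nat.findGreatest_le m, hspec,
      by rwa [dist_eq_norm] at hmε, fun k hk hkm => ?_⟩
    exact not_lt.1 (Nat.findGreatest_is_greatest hk hkm)
  have hch : ∀ n, ∃ m, (∃ m, P n m) → P n m := fun n => by
    by_cases hn : ∃ m, P n m
    · exact ⟨hn.choose, fun _ => hn.choose_spec⟩
    · exact ⟨0, fun h => absurd h hn⟩
  choose m hm using hch
  have := frequently_iff_neBot.1 hup
  set U : Ultrafilter ℕ := Ultrafilter.of (atTop ⊓ 𝓟 {n | ∃ m, P n m})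
  have hUle : (U : Filter ℕ) ≤ atTop ⊓ 𝓟 {n | ∃ m, P n m} := Ultrafilter.of_le _
  have hU : (U : Filter ℕ) ≤ atTop := hUle.trans inf_le_left
  have hUP : ∀ᶠ n in U, P n (m n) := by
    filter_upwards [le_principal_iff.1 (hUle.trans inf_le_right)] with n hn using hm n hn
  obtain ⟨y, hy, hyl⟩ := hmain U hU
  have hy0 : ‖y 0 - z‖ ≤ r := by
    refine le_of_tendsto ((hyl id 0 le_rfl (Eventually.of_forall fun n => le_rfl)
      (hzero _)).sub_const z).norm ?_
    filter_upwards [hUP] with n hn using hn.2.1.le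
  have hyz := hD y hy (hρD (by rw [Metric.mem_ball, dist_eq_norm]; linarith [hrm.2.2]))
  obtain ⟨T, hT, hT0⟩ := ((hyz.eventually (Metric.ball_mem_nhds z hr)).and
    (eventually_gt_atTop 0)).exists
  -- the limit solution returns to the small ball by the time `T`, which bounds the duration of
  -- the upcrossings
  obtain ⟨q, hq1, hq2⟩ := exists_index_at_time ha ha_lim ha_sum hT0.le
  have hq2U := hq2.mono_left hU
  have h1 := hyl q T hT0.le (Eventually.of_forall hq1) hq2U
  have hmq : ∀ᶠ n in U, m n < q n := by
    filter_upwards [h1.eventually_mem (Metric.isOpen_ball.mem_nhds hT), hUP,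
      hq2U.eventually_const_lt hT0] with n hn1 hn2 hn3
    by_contra! hle
    have hne : q n ≠ n := fun hqn => by rw [hqn] at hn3; simp at hn3
    have := hn2.2.2.2 (q n) (lt_of_le_of_ne (hq1 n) hne.symm) hle
    rw [Metric.mem_ball, dist_eq_norm] at hn1
    linarith
  have hbd : ∀ᶠ n in U, ∑ k ∈ Finset.range (m n), a k - ∑ k ∈ Finset.range n, a k ∈
      Icc 0 (T + 1) := by
    filter_upwards [hmq, hUP, hq2U.eventually_lt_const (lt_add_one T)] with n hn1 hn2 hn3
    exact ⟨sub_nonneg.2 (monotone_sum_range ha hn2.1),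
      (sub_le_sub_right (monotone_sum_range ha hn1.le) _).trans hn3.le⟩
  obtain ⟨t, ht, htl⟩ := (isCompact_Icc (a := (0 : ℝ)) (b := T + 1)).ultrafilter_le_nhds
    (U.map fun n => ∑ k ∈ Finset.range (m n), a k - ∑ k ∈ Finset.range n, a k)
    (by rw [le_principal_iff]; exact hbd)
  have h2 := hyl m t ht.1 (by filter_upwards [hUP] with n hn using hn.1) htl
  have h3 : ε ≤ ‖y t - z‖ := by
    refine ge_of_tendsto (h2.sub_const z).norm ?_
    filter_upwards [hUP] with n hn using hn.2.2.1
  linarith [hst y hy (by linarith [hrm.2.1]) t ht.1]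

end PerturbedEuler

/-! ### Gaussian smoothing of a gradient -/

section GaussianSmoothing

open scoped RealInnerProductSpace

variable {E : Type*} [NormedAddCommGroup E] [InnerProductSpace ℝ E] [FiniteDimensional ℝ E]
  [MeasurableSpace E] [BorelSpace E]

lemma integrable_exp_neg_mul_sq_norm {b : ℝ} (hb : 0 < b) :
    Integrable (fun v : E => Real.exp (-b * ‖v‖ ^ 2)) := by
  have h := (GaussianFourier.integrable_cexp_neg_mul_sq_norm_add (V := E) (b := (b : ℂ))
    (by simpa using hb) 0 0).re
  refine h.congr (Eventually.of_forall fun v => ?_)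
  have : -(b : ℂ) * (‖v‖ : ℂ) ^ 2 + 0 * ((inner ℝ (0 : E) v : ℝ) : ℂ) =
      ((-b * ‖v‖ ^ 2 : ℝ) : ℂ) := by push_cast; ring
  simp only [this]
  exact Complex.exp_ofReal_re _

lemma integral_exp_neg_half_sq_norm_pos : 0 < ∫ v : E, Real.exp (-(1 / 2) * ‖v‖ ^ 2) := by
  rw [GaussianFourier.integral_rexp_neg_mul_sq_norm (by norm_num)]
  positivity

/-- The density of the standard Gaussian distribution; the normalizing constant is left as an
integral. The two measures have the same characteristic function. -/
lemma stdGaussian_eq_withDensity :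
    stdGaussian E = volume.withDensity fun v => ENNReal.ofReal
      ((∫ v : E, Real.exp (-(1 / 2) * ‖v‖ ^ 2))⁻¹ * Real.exp (-(1 / 2) * ‖v‖ ^ 2)) := by
  set Z : ℝ := ∫ v : E, Real.exp (-(1 / 2) * ‖v‖ ^ 2) with hZ
  have hZ0 : 0 < Z := integral_exp_neg_half_sq_norm_pos
  have hfin : IsFiniteMeasure (volume.withDensity fun v : E => ENNReal.ofReal
      (Z⁻¹ * Real.exp (-(1 / 2) * ‖v‖ ^ 2))) :=
    isFiniteMeasure_withDensity_ofReal
      ((integrable_exp_neg_mul_sq_norm (E := E) (by norm_num : (0 : ℝ) < 1 / 2)).const_mul _).2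
  refine Measure.ext_of_charFun (funext fun t => ?_)
  rw [charFun_stdGaussian, charFun_apply, integral_withDensity_eq_integral_toReal_smul
    (by fun_prop) (by simp)]
  have e1 : ∀ v : E, (ENNReal.ofReal (Z⁻¹ * Real.exp (-(1 / 2) * ‖v‖ ^ 2))).toReal •
      Complex.exp (inner ℝ v t * Complex.I) =
      (Z : ℂ)⁻¹ * Complex.exp (-(1 / 2 : ℂ) * ‖v‖ ^ 2 + Complex.I * inner ℝ t v) := fun v => by
    rw [ENNReal.toReal_ofReal (by positivity), Complex.real_smul, Complex.exp_add,
      real_inner_comm, mul_comm Complex.I]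
    push_cast
    ring
  have hb : 0 < (1 / 2 : ℂ).re := by norm_num
  have e2 : (Z : ℂ) = (Real.pi / (1 / 2 : ℂ)) ^ (Module.finrank ℝ E / 2 : ℂ) := by
    rw [← GaussianFourier.integral_cexp_neg_mul_sq_norm hb, hZ, ← integral_complex_ofReal]
    refine integral_congr_ae (Eventually.of_forall fun v => ?_)
    push_cast
    rfl
  simp_rw [e1]
  rw [integral_const_mul, GaussianFourier.integral_cexp_neg_mul_sq_norm_add hb, ← e2,
    inv_mul_cancel_left₀ (by exact_mod_cast hZ0.ne')]
  congr 1
  rw [Complex.I_sq]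
  ring

lemma integrable_stdGaussian_iff {f : E → ℝ} :
    Integrable f (stdGaussian E) ↔
      Integrable (fun v => Real.exp (-(1 / 2) * ‖v‖ ^ 2) * f v) := by
  have hZ0 := integral_exp_neg_half_sq_norm_pos (E := E)
  rw [stdGaussian_eq_withDensity, integrable_withDensity_iff_integrable_smul'
    (by fun_prop) (by simp), ← integrable_const_mul_iff (inv_ne_zero hZ0.ne').isUnit
      (fun v => Real.exp (-(1 / 2) * ‖v‖ ^ 2) * f v)]
  refine integrable_congr (Eventually.of_forall fun v => ?_)
  simp only
  rw [ENNReal.toReal_ofReal (by positivity), smul_eq_mul, mul_assoc]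

lemma integral_stdGaussian_eq (f : E → ℝ) :
    ∫ v, f v ∂(stdGaussian E) = (∫ v : E, Real.exp (-(1 / 2) * ‖v‖ ^ 2))⁻¹ *
      ∫ v, Real.exp (-(1 / 2) * ‖v‖ ^ 2) * f v := by
  have hZ0 := integral_exp_neg_half_sq_norm_pos (E := E)
  rw [stdGaussian_eq_withDensity, integral_withDensity_eq_integral_toReal_smul
    (by fun_prop) (by simp), ← integral_const_mul]
  refine integral_congr_ae (Eventually.of_forall fun v => ?_)
  simp only
  rw [ENNReal.toReal_ofReal (by positivity), smul_eq_mul, mul_assoc]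

lemma exists_pow_mul_exp_neg_sq_le (n : ℕ) {η : ℝ} (hη : 0 < η) :
    ∃ r₀ > 0, ∀ r, r₀ ≤ r → r ^ n * Real.exp (-(1 / 4) * r ^ 2) ≤ η := by
  obtain ⟨r₀, hr₀⟩ := eventually_atTop.1
    ((Real.tendsto_pow_mul_exp_neg_atTop_nhds_zero n).eventually_le_const hη)
  refine ⟨max r₀ 4, by positivity, fun r hr => le_trans ?_ (hr₀ r ((le_max_left _ _).trans hr))⟩
  have h4 : 4 ≤ r := (le_max_right _ _).trans hr
  gcongr
  nlinarith

/-- A weighted second moment of `f` at a single point `z` and a single scale `s` makes `f`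
integrable against the Gaussian density with that center and scale. -/
lemma integrable_exp_mul_of_integrable_sq {f : E → ℝ} (hf : Continuous f) {z : E} {s : ℝ}
    (hint : Integrable (fun v => ‖v‖ ^ 2 * f (z + s • v) ^ 2) (stdGaussian E)) :
    Integrable (fun v => Real.exp (-(1 / 2) * ‖v‖ ^ 2) * f (z + s • v)) := by
  have hg := (integrable_stdGaussian_iff (E := E)).1 hint
  obtain ⟨B, hB⟩ := (isCompact_closedBall (0 : E) 1).exists_bound_of_continuousOn
    (f := fun v => f (z + s • v)) (by fun_prop)
  have hB0 : 0 ≤ B := (norm_nonneg _).trans (hB 0 (by simp))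
  have hgauss := integrable_exp_neg_mul_sq_norm (E := E) (b := 1 / 2) (by norm_num)
  refine ((hgauss.const_mul (B + 1)).add hg).mono' (by fun_prop)
    (Eventually.of_forall fun v => ?_)
  simp only [Pi.add_apply]
  rw [norm_mul, Real.norm_of_nonneg (Real.exp_pos _).le, mul_comm (B + 1), ← mul_add]
  refine mul_le_mul_of_nonneg_left ?_ (Real.exp_pos _).le
  by_cases hv : ‖v‖ ≤ 1
  · have := hB v (by simpa using hv)
    nlinarith [mul_nonneg (sq_nonneg ‖v‖) (sq_nonneg (f (z + s • v)))]
  · have h1 : 1 ≤ ‖v‖ ^ 2 := by nlinarith [not_le.1 hv]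
    rw [Real.norm_eq_abs]
    nlinarith [mul_le_mul_of_nonneg_right h1 (sq_nonneg (f (z + s • v))),
      sq_nonneg (|f (z + s • v)| - 1), sq_abs (f (z + s • v))]

/-- The part of the Gaussian smoothing that comes from the points further than `δ` from the center
is negligible for small scales `c`, uniformly for bounded centers: at those points the Gaussian
density with scale `c` is far below the density with center `z` and scale `s`, for which `f` is
integrable. -/
lemma exists_gaussian_tail_le {f : E → ℝ} (hf : Continuous f) {z : E} {s : ℝ} (hs : 0 < s)
    (hint : Integrable (fun v => ‖v‖ ^ 2 * f (z + s • v) ^ 2) (stdGaussian E))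
    (R : ℝ) {δ η : ℝ} (hδ : 0 < δ) (hη : 0 < η) :
    ∃ c₁ > 0, ∀ θ : E, ‖θ‖ ≤ R → ∀ c : ℝ, 0 < |c| → |c| < c₁ →
      Integrable (fun v => if δ < |c| * ‖v‖ then |f (θ + c • v)| * ‖v‖ / |c| else 0)
        (stdGaussian E) ∧
      ∫ v, (if δ < |c| * ‖v‖ then |f (θ + c • v)| * ‖v‖ / |c| else 0) ∂(stdGaussian E) ≤ η := by
  set d := Module.finrank ℝ E
  set Z : ℝ := ∫ v : E, Real.exp (-(1 / 2) * ‖v‖ ^ 2) with hZ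
  have hZ0 : 0 < Z := integral_exp_neg_half_sq_norm_pos
  -- `f` times the unnormalized Gaussian density with center `z` and scale `s`
  set W : E → ℝ := fun x => Real.exp (-(1 / 2) * ‖s⁻¹ • (x - z)‖ ^ 2) * |f x| with hW
  have hWint : Integrable W := by
    have h1 : Integrable (fun v => Real.exp (-(1 / 2) * ‖v‖ ^ 2) * |f (z + s • v)|) := by
      refine (integrable_exp_mul_of_integrable_sq hf hint).norm.congr
        (Eventually.of_forall fun v => ?_)
      simp
    have h2 := (h1.comp_smul (inv_ne_zero hs.ne')).comp_add_left (-z)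
    refine h2.congr (Eventually.of_forall fun x => ?_)
    simp only [hW]
    rw [smul_inv_smul₀ hs.ne', add_neg_cancel_left, neg_add_eq_sub]
  have hW0 : 0 ≤ ∫ x, W x := integral_nonneg fun x => by positivity
  set I : ℝ := Z⁻¹ * ∫ x, W x with hI
  have hI0 : 0 ≤ I := by positivity
  set η' : ℝ := η / (I + 1) with hη'
  have hη'0 : 0 < η' := by positivity
  obtain ⟨r₀, hr₀, hr⟩ := exists_pow_mul_exp_neg_sq_le (d + 2) (η := η' * δ ^ (d + 1))
    (by positivity)
  have hRz : 0 ≤ |R| + ‖z‖ := by positivity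
  set A : ℝ := 1 + (|R| + ‖z‖) / δ with hA
  have hA0 : 0 < A := by positivity
  refine ⟨min (δ / r₀) (s / (2 * A)), by positivity, fun θ hθ c hc0 hc => ?_⟩
  rw [lt_min_iff] at hc
  have hcne : c ≠ 0 := abs_pos.1 hc0
  -- the comparison of the densities
  have hpt : ∀ v : E, Real.exp (-(1 / 2) * ‖v‖ ^ 2) *
      (if δ < |c| * ‖v‖ then |f (θ + c • v)| * ‖v‖ / |c| else 0) ≤
      η' * |c| ^ d * W (θ + c • v) := by
    intro v
    split_ifs with hv
    swap
    · rw [mul_zero]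
      positivity
    have hr1 : r₀ ≤ ‖v‖ := by
      have h1 := (lt_div_iff₀ hr₀).1 hc.1
      by_contra! hlt
      nlinarith
    have hcr : |c|⁻¹ ≤ ‖v‖ / δ := by
      rw [inv_eq_one_div, div_le_div_iff₀ hc0 hδ]
      linarith
    have hv0 : 0 ≤ ‖v‖ := norm_nonneg v
    have hE1 : ‖v‖ * |c|⁻¹ ^ (d + 1) * Real.exp (-(1 / 4) * ‖v‖ ^ 2) ≤ η' := by
      calc ‖v‖ * |c|⁻¹ ^ (d + 1) * Real.exp (-(1 / 4) * ‖v‖ ^ 2)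
          ≤ ‖v‖ * (‖v‖ / δ) ^ (d + 1) * Real.exp (-(1 / 4) * ‖v‖ ^ 2) := by gcongr
        _ = (‖v‖ ^ (d + 2) * Real.exp (-(1 / 4) * ‖v‖ ^ 2)) / δ ^ (d + 1) := by
            rw [div_pow]; ring
        _ ≤ η' := by
            rw [div_le_iff₀ (by positivity)]
            exact hr _ hr1
    have hnorm : ‖s⁻¹ • (θ + c • v - z)‖ ^ 2 ≤ 1 / 4 * ‖v‖ ^ 2 + 1 / 4 * ‖v‖ ^ 2 := by
      have h1 : ‖θ + c • v - z‖ ≤ A * (|c| * ‖v‖) := by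
        have h2 : ‖θ + c • v - z‖ ≤ |R| + ‖z‖ + |c| * ‖v‖ := by
          have h3 := norm_sub_le (θ + c • v) z
          have h4 := norm_add_le θ (c • v)
          rw [norm_smul, Real.norm_eq_abs] at h4
          have := le_abs_self R
          linarith
        have h5 : |R| + ‖z‖ ≤ (|R| + ‖z‖) / δ * (|c| * ‖v‖) := by
          rw [div_mul_eq_mul_div, le_div_iff₀ hδ]
          nlinarith
        rw [hA]
        linarith
      have h6 : A * |c| ≤ s / 2 := by
        have := hc.2.le
        rw [le_div_iff₀ (by positivity)] at this
        linarith
      have h7 : ‖s⁻¹ • (θ + c • v - z)‖ ≤ 1 / 2 * ‖v‖ := by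
        rw [norm_smul, Real.norm_of_nonneg (by positivity), inv_mul_le_iff₀ hs]
        nlinarith
      nlinarith [norm_nonneg (s⁻¹ • (θ + c • v - z))]
    have hE2 : Real.exp (-(1 / 2) * ‖v‖ ^ 2) ≤ Real.exp (-(1 / 4) * ‖v‖ ^ 2) *
        Real.exp (-(1 / 2) * ‖s⁻¹ • (θ + c • v - z)‖ ^ 2) := by
      rw [← Real.exp_add]
      gcongr
      linarith
    calc Real.exp (-(1 / 2) * ‖v‖ ^ 2) * (|f (θ + c • v)| * ‖v‖ / |c|)
        ≤ (Real.exp (-(1 / 4) * ‖v‖ ^ 2) *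
          Real.exp (-(1 / 2) * ‖s⁻¹ • (θ + c • v - z)‖ ^ 2)) *
          (|f (θ + c • v)| * ‖v‖ / |c|) := by gcongr
      _ = (‖v‖ * |c|⁻¹ ^ (d + 1) * Real.exp (-(1 / 4) * ‖v‖ ^ 2)) * |c| ^ d *
          W (θ + c • v) := by
          simp only [hW, inv_pow]
          field_simp
          ring
      _ ≤ η' * |c| ^ d * W (θ + c • v) := by
          have : 0 ≤ W (θ + c • v) := by positivity
          gcongr
  have hWc : Integrable (fun v => W (θ + c • v)) :=
    (hWint.comp_add_left θ).comp_smul hcne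
  have hWi : ∫ v, W (θ + c • v) = (|c| ^ d)⁻¹ * ∫ x, W x := by
    rw [Measure.integral_comp_smul volume (fun x => W (θ + x)) c, integral_add_left_eq_self,
      smul_eq_mul, abs_inv, abs_pow]
  have hmeas : Measurable (fun v : E => Real.exp (-(1 / 2) * ‖v‖ ^ 2) *
      (if δ < |c| * ‖v‖ then |f (θ + c • v)| * ‖v‖ / |c| else 0)) := by
    refine Measurable.mul (by fun_prop) (Measurable.ite ?_ (by fun_prop) measurable_const)
    exact measurableSet_lt measurable_const (by fun_prop)
  have hnn : ∀ v : E, 0 ≤ Real.exp (-(1 / 2) * ‖v‖ ^ 2) *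
      (if δ < |c| * ‖v‖ then |f (θ + c • v)| * ‖v‖ / |c| else 0) := fun v => by
    split_ifs <;> positivity
  refine ⟨integrable_stdGaussian_iff.2 ?_, ?_⟩
  · refine (hWc.const_mul (η' * |c| ^ d)).mono' hmeas.aestronglyMeasurable
      (Eventually.of_forall fun v => ?_)
    rw [Real.norm_of_nonneg (hnn v)]
    exact hpt v
  · rw [integral_stdGaussian_eq, ← hZ]
    calc Z⁻¹ * ∫ v, Real.exp (-(1 / 2) * ‖v‖ ^ 2) *
          (if δ < |c| * ‖v‖ then |f (θ + c • v)| * ‖v‖ / |c| else 0)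
        ≤ Z⁻¹ * ∫ v, η' * |c| ^ d * W (θ + c • v) := by
          refine mul_le_mul_of_nonneg_left ?_ (by positivity)
          exact integral_mono_of_nonneg (Eventually.of_forall hnn) (hWc.const_mul _)
            (Eventually.of_forall hpt)
      _ = η' * I := by
          rw [integral_const_mul, hWi, hI]
          field_simp
      _ ≤ η := by
          rw [hη', div_mul_eq_mul_div, div_le_iff₀ (by positivity)]
          nlinarith

lemma integrable_norm_pow_stdGaussian (n : ℕ) (hn : n ≠ 0) :
    Integrable (fun v : E => ‖v‖ ^ n) (stdGaussian E) :=
  (IsGaussian.memLp_id (stdGaussian E) n (by simp)).integrable_norm_pow hn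

lemma integrable_inner_stdGaussian (u : E) : Integrable (fun v : E => ⟪u, v⟫) (stdGaussian E) :=
  ((innerSL ℝ u).integrable_comp IsGaussian.integrable_id)

lemma integral_inner_stdGaussian (u : E) : ∫ v : E, ⟪u, v⟫ ∂(stdGaussian E) = 0 :=
  integral_strongDual_stdGaussian (innerSL ℝ u)

lemma integrable_inner_mul_inner_stdGaussian (u w : E) :
    Integrable (fun v : E => ⟪u, v⟫ * ⟪w, v⟫) (stdGaussian E) := by
  refine ((integrable_norm_pow_stdGaussian (E := E) 2 two_ne_zero).const_mul (‖u‖ * ‖w‖)).mono'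
    (by fun_prop) (Eventually.of_forall fun v => ?_)
  rw [norm_mul]
  calc ‖⟪u, v⟫‖ * ‖⟪w, v⟫‖ ≤ (‖u‖ * ‖v‖) * (‖w‖ * ‖v‖) := by
        gcongr <;> exact norm_inner_le_norm _ _
    _ = _ := by ring

lemma integral_inner_mul_inner_stdGaussian (u w : E) :
    ∫ v : E, ⟪u, v⟫ * ⟪w, v⟫ ∂(stdGaussian E) = ⟪u, w⟫ := by
  have h := covarianceBilin_apply (μ := stdGaussian E) IsGaussian.memLp_two_id u w
  rw [covarianceBilin_stdGaussian] at h
  simpa [innerSL_apply_apply ℝ] using h.symm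

/-- The component in direction `u` of the gradient of `L` smoothed at scale `c`, written, with
Stein's identity, without derivatives as `c⁻¹ E[L (θ + c v) ⟪u, v⟫]` for a standard Gaussian `v`. -/
noncomputable def gaussianSmoothedGradient (L : E → ℝ) (u : E) (c : ℝ) (θ : E) : ℝ :=
  c⁻¹ * ∫ v, L (θ + c • v) * ⟪u, v⟫ ∂(stdGaussian E)

/-- Gaussian smoothing gives the gradient in the limit of small scales, uniformly for bounded
centers. Points near to `θ` contribute by the uniform
continuity of the derivative on compact sets, far points by `exists_gaussian_tail_le`. -/
lemma exists_gaussian_smoothing_sub_gradient_le {L : E → ℝ} (hL : ContDiff ℝ 1 L) {z : E} {s : ℝ}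
    (hs : 0 < s)
    (hint : Integrable (fun v => ‖v‖ ^ 2 * L (z + s • v) ^ 2) (stdGaussian E))
    {u : E} (hu : ‖u‖ ≤ 1) (R : ℝ) {η : ℝ} (hη : 0 < η) :
    ∃ c₁ > 0, ∀ θ : E, ‖θ‖ ≤ R → ∀ c : ℝ, 0 < |c| → |c| < c₁ →
      |gaussianSmoothedGradient L u c θ - ⟪u, gradient L θ⟫| ≤ η := by
  have hLc : Continuous L := hL.continuous
  have hLd : Differentiable ℝ L := hL.differentiable (by simp)
  have hfc : Continuous (fderiv ℝ L) := hL.continuous_fderiv (by simp)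
  set M₂ : ℝ := ∫ v : E, ‖v‖ ^ 2 ∂(stdGaussian E)
  set M₃ : ℝ := ∫ v : E, ‖v‖ ^ 3 ∂(stdGaussian E)
  have hM₂ : 0 ≤ M₂ := integral_nonneg fun v => by positivity
  have hM₃ : 0 ≤ M₃ := integral_nonneg fun v => by positivity
  set η' : ℝ := η / (3 * (M₂ + 1)) with hη'
  have hη'0 : 0 < η' := by positivity
  -- uniform first-order expansion near to bounded points
  obtain ⟨δ, hδ, hnear⟩ : ∃ δ > 0, ∀ θ : E, ‖θ‖ ≤ R → ∀ w : E, ‖w‖ ≤ δ →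
      |L (θ + w) - L θ - fderiv ℝ L θ w| ≤ η' * ‖w‖ := by
    obtain ⟨δ, hδ, hδu⟩ := Metric.uniformContinuousOn_iff.1
      ((isCompact_closedBall (0 : E) (R + 1)).uniformContinuousOn_of_continuous hfc.continuousOn)
      η' hη'0
    refine ⟨min (δ / 2) 1, by positivity, fun θ hθ w hw => ?_⟩
    have hw' := le_min_iff.1 hw
    have := (convex_closedBall θ (min (δ / 2) 1)).norm_image_sub_le_of_norm_fderiv_le'
      (𝕜 := ℝ) (f := L) (φ := fderiv ℝ L θ) (C := η') (x := θ) (y := θ + w)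
      (fun x _ => hLd x) (fun x hx => ?_) (by simp; positivity) (by simpa using hw)
    · simpa using this
    · rw [Metric.mem_closedBall, le_min_iff] at hx
      rw [← dist_eq_norm]
      refine (hδu x ?_ θ ?_ (by linarith)).le
      · rw [mem_closedBall_zero_iff]
        have := norm_le_norm_add_norm_sub' x θ
        rw [← dist_eq_norm] at this
        linarith
      · rw [mem_closedBall_zero_iff]
        linarith
  obtain ⟨B, hB⟩ := (isCompact_closedBall (0 : E) R).exists_bound_of_continuousOn hLc.continuousOn
  obtain ⟨G, hG⟩ := (isCompact_closedBall (0 : E) R).exists_bound_of_continuousOn hfc.continuousOn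
  obtain ⟨c₂, hc₂, htail⟩ := exists_gaussian_tail_le hLc hs hint R hδ (η := η / 3) (by positivity)
  set Q : ℝ := |B| / δ ^ 2 + |G| / δ with hQ
  have hQ0 : 0 ≤ Q := by positivity
  refine ⟨min c₂ (η / (3 * (Q * M₃ + 1))), by positivity, fun θ hθ c hc0 hc => ?_⟩
  rw [lt_min_iff] at hc
  obtain ⟨hti, htl⟩ := htail θ hθ c hc0 hc.1
  have hcne : c ≠ 0 := abs_pos.1 hc0
  have hBθ : |L θ| ≤ |B| := (hB θ (by simpa using hθ)).trans (le_abs_self B)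
  have hGθ : ‖fderiv ℝ L θ‖ ≤ |G| := (hG θ (by simpa using hθ)).trans (le_abs_self G)
  set f : E → ℝ := fun v => (c⁻¹ * (L (θ + c • v) - L θ) - fderiv ℝ L θ v) * ⟪u, v⟫ with hf
  set t : E → ℝ := fun v => if δ < |c| * ‖v‖ then |L (θ + c • v)| * ‖v‖ / |c| else 0 with ht
  have hbound : ∀ v, ‖f v‖ ≤ η' * ‖v‖ ^ 2 + t v + |c| * Q * ‖v‖ ^ 3 := by
    intro v
    have hiu : |⟪u, v⟫| ≤ ‖v‖ := by
      refine (abs_real_inner_le_norm u v).trans ?_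
      nlinarith [norm_nonneg v]
    have hv0 := norm_nonneg v
    rw [hf, Real.norm_eq_abs, abs_mul]
    by_cases hv : δ < |c| * ‖v‖
    · have h1 : |fderiv ℝ L θ v| ≤ |G| * ‖v‖ :=
        ((fderiv ℝ L θ).le_opNorm v).trans (by gcongr)
      have h2 : |c⁻¹ * (L (θ + c • v) - L θ) - fderiv ℝ L θ v| ≤
          |c|⁻¹ * (|L (θ + c • v)| + |B|) + |G| * ‖v‖ := by
        refine (abs_sub _ _).trans (add_le_add ?_ h1)
        rw [abs_mul, abs_inv]
        gcongr
        exact (abs_sub _ _).trans (by gcongr)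
      have h3 : |c|⁻¹ * |B| * ‖v‖ ≤ |c| * (|B| / δ ^ 2) * ‖v‖ ^ 3 := by
        have h4 : 1 ≤ (|c| * ‖v‖ / δ) ^ 2 := one_le_pow₀ ((one_le_div hδ).2 hv.le)
        calc |c|⁻¹ * |B| * ‖v‖ ≤ |c|⁻¹ * |B| * ‖v‖ * (|c| * ‖v‖ / δ) ^ 2 :=
              le_mul_of_one_le_right (by positivity) h4
          _ = |c| * (|B| / δ ^ 2) * ‖v‖ ^ 3 := by field_simp
      have h5 : |G| * ‖v‖ * ‖v‖ ≤ |c| * (|G| / δ) * ‖v‖ ^ 3 := by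
        have h4 : 1 ≤ |c| * ‖v‖ / δ := (one_le_div hδ).2 hv.le
        calc |G| * ‖v‖ * ‖v‖ ≤ |G| * ‖v‖ * ‖v‖ * (|c| * ‖v‖ / δ) :=
              le_mul_of_one_le_right (by positivity) h4
          _ = |c| * (|G| / δ) * ‖v‖ ^ 3 := by field_simp
      have htv : t v = |c|⁻¹ * |L (θ + c • v)| * ‖v‖ := by
        rw [ht]
        simp only [if_pos hv]
        ring
      calc _ ≤ (|c|⁻¹ * (|L (θ + c • v)| + |B|) + |G| * ‖v‖) * ‖v‖ := by gcongr
        _ = t v + (|c|⁻¹ * |B| * ‖v‖ + |G| * ‖v‖ * ‖v‖) := by rw [htv]; ring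
        _ ≤ t v + (|c| * (|B| / δ ^ 2) * ‖v‖ ^ 3 + |c| * (|G| / δ) * ‖v‖ ^ 3) := by gcongr
        _ = t v + |c| * Q * ‖v‖ ^ 3 := by rw [hQ]; ring
        _ ≤ _ := by
          have : 0 ≤ η' * ‖v‖ ^ 2 := by positivity
          linarith
    · have htv : t v = 0 := by simp only [ht, if_neg hv]
      have h1 := hnear θ hθ (c • v) (by rw [norm_smul, Real.norm_eq_abs]; exact not_lt.1 hv)
      rw [map_smul, norm_smul, Real.norm_eq_abs, smul_eq_mul] at h1
      have h2 : |c⁻¹ * (L (θ + c • v) - L θ) - fderiv ℝ L θ v| ≤ η' * ‖v‖ := by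
        have : c⁻¹ * (L (θ + c • v) - L θ) - fderiv ℝ L θ v =
            c⁻¹ * (L (θ + c • v) - L θ - c * fderiv ℝ L θ v) := by field_simp
        rw [this, abs_mul, abs_inv, inv_mul_le_iff₀ hc0]
        linarith
      calc _ ≤ η' * ‖v‖ * ‖v‖ := by gcongr
        _ ≤ _ := by
          rw [htv]
          have : 0 ≤ |c| * Q * ‖v‖ ^ 3 := by positivity
          nlinarith
  have hb1 : Integrable (fun v => η' * ‖v‖ ^ 2) (stdGaussian E) :=
    (integrable_norm_pow_stdGaussian 2 two_ne_zero).const_mul _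
  have hb2 : Integrable (fun v => η' * ‖v‖ ^ 2 + t v) (stdGaussian E) := hb1.add hti
  have hb3 : Integrable (fun v => |c| * Q * ‖v‖ ^ 3) (stdGaussian E) :=
    (integrable_norm_pow_stdGaussian 3 three_ne_zero).const_mul _
  have hbi : Integrable (fun v => η' * ‖v‖ ^ 2 + t v + |c| * Q * ‖v‖ ^ 3) (stdGaussian E) :=
    hb2.add hb3
  have hfi : Integrable f (stdGaussian E) :=
    hbi.mono' (Continuous.aestronglyMeasurable (by fun_prop)) (Eventually.of_forall hbound)
  have hfe : ∫ v, f v ∂(stdGaussian E) =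
      c⁻¹ * ∫ v, L (θ + c • v) * ⟪u, v⟫ ∂(stdGaussian E) - ⟪u, gradient L θ⟫ := by
    have h1 : ∀ v, c⁻¹ * (L (θ + c • v) * ⟪u, v⟫) =
        f v + (c⁻¹ * L θ * ⟪u, v⟫ + ⟪gradient L θ, v⟫ * ⟪u, v⟫) := fun v => by
      rw [hf, gradient, InnerProductSpace.toDual_symm_apply]
      ring
    have hi1 : Integrable (fun v : E => c⁻¹ * L θ * ⟪u, v⟫) (stdGaussian E) :=
      (integrable_inner_stdGaussian u).const_mul _
    have hi2 := integrable_inner_mul_inner_stdGaussian (gradient L θ) u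
    have hi3 : Integrable (fun v : E => c⁻¹ * L θ * ⟪u, v⟫ + ⟪gradient L θ, v⟫ * ⟪u, v⟫)
      (stdGaussian E) := hi1.add hi2
    rw [← integral_const_mul, integral_congr_ae (Eventually.of_forall h1),
      integral_add hfi hi3, integral_add hi1 hi2, integral_const_mul,
      integral_inner_stdGaussian, integral_inner_mul_inner_stdGaussian, real_inner_comm]
    ring
  rw [gaussianSmoothedGradient, ← hfe, ← Real.norm_eq_abs]
  refine (norm_integral_le_of_norm_le hbi (Eventually.of_forall hbound)).trans ?_
  rw [integral_add hb2 hb3, integral_add hb1 hti, integral_const_mul, integral_const_mul]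
  have hp1 : η' * M₂ ≤ η / 3 := by
    rw [hη', div_mul_eq_mul_div, div_le_div_iff₀ (by positivity) (by positivity)]
    nlinarith
  have hp2 : |c| * Q * M₃ ≤ η / 3 := by
    have h1 := hc.2.le
    rw [le_div_iff₀ (by positivity)] at h1
    linarith
  linarith

end GaussianSmoothing

/-! ### Conditional expectation and martingale convergence -/

section CondExp

variable {Ω : Type*} {m₀ : MeasurableSpace Ω} {μ : Measure Ω}

lemma condExp_comap_ae_eq_integral_map_of_indepFun [IsFiniteMeasure μ] {α β : Type*}
    {mα : MeasurableSpace α} [MeasurableSpace β] [StandardBorelSpace β] [Nonempty β]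
    {X : Ω → α} {Y : Ω → β} (hX : Measurable X) (hY : Measurable Y) (hXY : IndepFun X Y μ)
    {f : α × β → ℝ} (hf : StronglyMeasurable f) (hint : Integrable (fun ω => f (X ω, Y ω)) μ) :
    μ[fun ω => f (X ω, Y ω) | mα.comap X] =ᵐ[μ] fun ω => ∫ y, f (X ω, y) ∂(μ.map Y) := by
  have h1 := condExp_prod_ae_eq_integral_condDistrib hX hY.aemeasurable hf hint
  have h2 : condDistrib Y X μ =ᵐ[μ.map X] Kernel.const α (μ.map Y) :=
    condDistrib_ae_eq_of_measure_eq_compProd_of_measurable hX hY (by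
      rw [Measure.compProd_const]
      exact (indepFun_iff_map_prod_eq_prod_map_map hX.aemeasurable hY.aemeasurable).1 hXY)
  filter_upwards [h1, ae_of_ae_map hX.aemeasurable h2] with ω hω1 hω2
  rw [hω1, hω2, Kernel.const_apply]

lemma integral_mul_sub_condExp_eq_zero [IsFiniteMeasure μ] {m : MeasurableSpace Ω} (hm : m ≤ m₀)
    {X Y : Ω → ℝ} (hX : MemLp X 2 μ) (hY : MemLp Y 2 μ) (hYm : StronglyMeasurable[m] Y) :
    ∫ ω, Y ω * (X ω - (μ[X | m]) ω) ∂μ = 0 := by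
  have hX1 : Integrable X μ := hX.integrable one_le_two
  have hd : MemLp (X - μ[X | m]) 2 μ := hX.sub (hX.condExp one_le_two)
  have h1 : μ[Y * (X - μ[X | m]) | m] =ᵐ[μ] 0 := by
    have h2 := condExp_mul_of_stronglyMeasurable_left (m := m) hYm (hY.integrable_mul hd)
      (hd.integrable one_le_two)
    have h3 := condExp_sub hX1 (integrable_condExp (f := X) (m := m) (μ := μ)) m
    have h4 : μ[μ[X | m] | m] = μ[X | m] :=
      condExp_of_stronglyMeasurable hm stronglyMeasurable_condExp integrable_condExp
    filter_upwards [h2, h3] with ω hω2 hω3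
    rw [hω2, Pi.mul_apply, hω3, h4]
    simp
  have h5 := integral_condExp (f := Y * (X - μ[X | m])) (μ := μ) hm
  rw [integral_congr_ae h1] at h5
  simpa using h5.symm

lemma integral_sq_sub_condExp_le [IsFiniteMeasure μ] {m : MeasurableSpace Ω} (hm : m ≤ m₀)
    {X : Ω → ℝ} (hX : MemLp X 2 μ) :
    ∫ ω, (X ω - (μ[X | m]) ω) ^ 2 ∂μ ≤ ∫ ω, X ω ^ 2 ∂μ := by
  have hC : MemLp (μ[X | m]) 2 μ := hX.condExp one_le_two
  have hd : MemLp (fun ω => X ω - (μ[X | m]) ω) 2 μ := hX.sub hC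
  have h0 := integral_mul_sub_condExp_eq_zero hm hX hC stronglyMeasurable_condExp
  have h1 : ∀ ω, X ω ^ 2 = (X ω - (μ[X | m]) ω) ^ 2 +
      (2 * ((μ[X | m]) ω * (X ω - (μ[X | m]) ω)) + (μ[X | m]) ω ^ 2) := fun ω => by ring
  have hi1 : Integrable (fun ω => (X ω - (μ[X | m]) ω) ^ 2) μ := hd.integrable_sq
  have hi2 : Integrable (fun ω => 2 * ((μ[X | m]) ω * (X ω - (μ[X | m]) ω))) μ :=
    (hC.integrable_mul hd).const_mul 2
  have hi3 : Integrable (fun ω => (μ[X | m]) ω ^ 2) μ := hC.integrable_sq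
  have hi4 : Integrable (fun ω => 2 * ((μ[X | m]) ω * (X ω - (μ[X | m]) ω)) +
    (μ[X | m]) ω ^ 2) μ := hi2.add hi3
  rw [integral_congr_ae (Eventually.of_forall h1), integral_add hi1 hi4, integral_add hi2 hi3,
    integral_const_mul, h0, mul_zero, zero_add]
  have : 0 ≤ ∫ ω, (μ[X | m]) ω ^ 2 ∂μ := integral_nonneg fun ω => sq_nonneg _
  linarith

/-- The centered sums of square-integrable variables with summable second moments form an
`L²`-bounded martingale and hence converge almost surely. -/
lemma ae_exists_tendsto_sum_sub_condExp [IsProbabilityMeasure μ] {ℱ : Filtration ℕ m₀}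
    {X : ℕ → Ω → ℝ} (hXm : ∀ k, StronglyMeasurable[ℱ (k + 1)] (X k)) (hX : ∀ k, MemLp (X k) 2 μ)
    (hsum : Summable fun k => ∫ ω, X k ω ^ 2 ∂μ) :
    ∀ᵐ ω ∂μ, ∃ l, Tendsto (fun n => ∑ k ∈ Finset.range n, (X k ω - (μ[X k | ℱ k]) ω))
      atTop (𝓝 l) := by
  set D : ℕ → Ω → ℝ := fun k ω => X k ω - (μ[X k | ℱ k]) ω with hD
  set M : ℕ → Ω → ℝ := fun n ω => ∑ k ∈ Finset.range n, D k ω with hM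
  have hDm : ∀ k, StronglyMeasurable[ℱ (k + 1)] (D k) := fun k =>
    (hXm k).sub (stronglyMeasurable_condExp.mono (ℱ.mono (Nat.le_succ k)))
  have hD2 : ∀ k, MemLp (D k) 2 μ := fun k => (hX k).sub ((hX k).condExp one_le_two)
  have hDc : ∀ k, μ[D k | ℱ k] =ᵐ[μ] 0 := fun k => by
    have h3 := condExp_sub ((hX k).integrable one_le_two)
      (integrable_condExp (f := X k) (m := ℱ k) (μ := μ)) (ℱ k)
    have h4 : μ[μ[X k | ℱ k] | ℱ k] = μ[X k | ℱ k] :=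
      condExp_of_stronglyMeasurable (ℱ.le k) stronglyMeasurable_condExp integrable_condExp
    filter_upwards [h3] with ω hω
    have : (μ[D k | ℱ k]) ω = (μ[X k - μ[X k | ℱ k] | ℱ k]) ω := rfl
    rw [this, hω, h4]
    simp
  have hMm : ∀ n, StronglyMeasurable[ℱ n] (M n) := fun n =>
    Finset.stronglyMeasurable_fun_sum _ fun k hk =>
      (hDm k).mono (ℱ.mono (Finset.mem_range.1 hk))
  have hM2 : ∀ n, MemLp (M n) 2 μ := fun n => memLp_finsetSum _ fun k _ => hD2 k
  have hMs : ∀ n, M (n + 1) = M n + D n := fun n => by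
    ext ω
    simp [hM, Finset.sum_range_succ]
  have hmart : Martingale M ℱ μ := by
    refine martingale_nat hMm (fun n => (hM2 n).integrable one_le_two) fun n => ?_
    have h1 := condExp_add ((hM2 n).integrable one_le_two) ((hD2 n).integrable one_le_two) (ℱ n)
    have h2 : μ[M n | ℱ n] = M n :=
      condExp_of_stronglyMeasurable (ℱ.le n) (hMm n) ((hM2 n).integrable one_le_two)
    rw [hMs n]
    filter_upwards [h1, hDc n] with ω hω1 hω2
    rw [hω1, Pi.add_apply, h2, hω2]
    simp
  have hsq : ∀ n, ∫ ω, M n ω ^ 2 ∂μ ≤ ∑ k ∈ Finset.range n, ∫ ω, X k ω ^ 2 ∂μ := fun n => by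
    induction n with
    | zero => simp [hM]
    | succ n ih =>
      have h0 := integral_mul_sub_condExp_eq_zero (ℱ.le n) (hX n) (hM2 n) (hMm n)
      have h1 : ∀ ω, M (n + 1) ω ^ 2 = M n ω ^ 2 + (2 * (M n ω * D n ω) + D n ω ^ 2) := fun ω => by
        rw [hMs n, Pi.add_apply]
        ring
      have hi1 : Integrable (fun ω => M n ω ^ 2) μ := (hM2 n).integrable_sq
      have hi2 : Integrable (fun ω => 2 * (M n ω * D n ω)) μ :=
        ((hM2 n).integrable_mul (hD2 n)).const_mul 2
      have hi3 : Integrable (fun ω => D n ω ^ 2) μ := (hD2 n).integrable_sq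
      have hi4 : Integrable (fun ω => 2 * (M n ω * D n ω) + D n ω ^ 2) μ := hi2.add hi3
      rw [Finset.sum_range_succ, integral_congr_ae (Eventually.of_forall h1),
        integral_add hi1 hi4, integral_add hi2 hi3, integral_const_mul, h0]
      linarith [integral_sq_sub_condExp_le (ℱ.le n) (hX n)]
  set R : ℝ := ∑' k, ∫ ω, X k ω ^ 2 ∂μ
  have hR : ∀ n, ∫ ω, M n ω ^ 2 ∂μ ≤ R := fun n => (hsq n).trans
    (hsum.sum_le_tsum _ fun k _ => integral_nonneg fun ω => sq_nonneg _)
  refine hmart.submartingale.exists_ae_tendsto_of_bdd (R := (1 + R).toNNReal) fun n => ?_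
  -- `‖M n‖₁ ≤ 1 + ‖M n‖₂²`
  rw [eLpNorm_one_eq_lintegral_enorm,
    ← ofReal_integral_norm_eq_lintegral_enorm ((hM2 n).integrable one_le_two)]
  refine ENNReal.ofReal_le_ofReal (le_trans ?_ (add_le_add_right (hR n) 1))
  have h1 : ∫ ω, (1 + M n ω ^ 2) ∂μ = 1 + ∫ ω, M n ω ^ 2 ∂μ := by
    rw [integral_add (integrable_const _) (hM2 n).integrable_sq]
    simp
  rw [← h1]
  refine integral_mono ((hM2 n).integrable one_le_two).norm
    ((integrable_const _).add (hM2 n).integrable_sq) fun ω => ?_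
  simp only [Real.norm_eq_abs]
  nlinarith [sq_nonneg (|M n ω| - 1), sq_abs (M n ω), abs_nonneg (M n ω)]

end CondExp

/-! ### Convergence of a path of a stochastic approximation scheme -/

section KushnerClark

/-- Almost sure convergence for one path of a stochastic approximation scheme
`θ (k + 1) = θ k - a k • h k - d k`, with `h k` asymptotically equal to `g (θ k)` and the sum of the
`d k` convergent. -/
lemma tendsto_of_stochastic_approximation {E : Type*} [NormedAddCommGroup E] [NormedSpace ℝ E]
    [ProperSpace E] {g : E → E} (hg : Continuous g)
    {θ h d : ℕ → E} {a : ℕ → ℝ} (ha : ∀ k, 0 < a k) (ha_lim : Tendsto a atTop (𝓝 0))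
    (ha_sum : Tendsto (fun n => ∑ k ∈ Finset.range n, a k) atTop atTop) {N : ℕ}
    (hrec : ∀ k, N ≤ k → θ (k + 1) = θ k - a k • h k - d k) {B : ℝ} (hB : ∀ k, ‖θ k‖ ≤ B)
    (hh : Tendsto (fun k => h k - g (θ k)) atTop (𝓝 0)) {l : E}
    (hd : Tendsto (fun n => ∑ k ∈ Finset.range n, d k) atTop (𝓝 l)) {z : E} {D : Set E}
    (hD : ∀ y : ℝ → E, IsIntegralCurveOn y (fun _ z => -g z) (Ici 0) → y 0 ∈ D →
      Tendsto y atTop (𝓝 z)) (hDz : D ∈ 𝓝 z)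
    (hstable : ∀ ε > 0, ∃ δ > 0, ∀ y : ℝ → E, IsIntegralCurveOn y (fun _ z => -g z) (Ici 0) →
      ‖y 0 - z‖ < δ → ∀ t, 0 ≤ t → ‖y t - z‖ < ε)
    {S : Set E} (hS : IsCompact S) (hSD : S ⊆ D) (hrecur : ∃ᶠ k in atTop, θ k ∈ S) :
    Tendsto θ atTop (𝓝 z) := by
  -- the noise is absorbed by shifting the iterates by the tails of its sum
  set w : ℕ → E := fun n => ∑ k ∈ Finset.range n, d k - l with hw
  have hw0 : Tendsto w atTop (𝓝 0) := by simpa using hd.sub_const l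
  set x : ℕ → E := fun n => θ n + w n with hx
  have hxrec : ∀ k, N ≤ k → x (k + 1) = x k - a k • h k := fun k hk => by
    simp only [hx, hw, hrec k hk, Finset.sum_range_succ]
    abel
  obtain ⟨B', hB'⟩ : ∃ B', ∀ k, ‖x k‖ ≤ B' := by
    obtain ⟨C, hC⟩ := (Metric.isBounded_range_of_tendsto w hw0).exists_norm_le
    exact ⟨B + C, fun k => (norm_add_le _ _).trans (add_le_add (hB k) (hC _ ⟨k, rfl⟩))⟩
  have hgx : Tendsto (fun k => g (θ k) - g (x k)) atTop (𝓝 0) := by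
    rw [Metric.tendsto_atTop]
    intro ε hε
    obtain ⟨δ, hδ, hδu⟩ := Metric.uniformContinuousOn_iff.1
      ((isCompact_closedBall (0 : E) (max B B')).uniformContinuousOn_of_continuous hg.continuousOn)
      ε hε
    obtain ⟨n₀, hn₀⟩ := Metric.tendsto_atTop.1 hw0 δ hδ
    refine ⟨n₀, fun n hn => ?_⟩
    rw [dist_zero_right, ← dist_eq_norm]
    refine hδu _ (by simpa using Or.inl (hB n)) _ (by simpa using Or.inr (hB' n)) ?_
    have := hn₀ n hn
    rw [dist_zero_right] at this
    simpa [hx, dist_eq_norm] using this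
  have hhx : Tendsto (fun k => h k - g (x k)) atTop (𝓝 0) := by
    simpa using hh.add hgx
  obtain ⟨s, hsS, hs⟩ := hS.exists_mapClusterPt_of_frequently hrecur
  have hsx : MapClusterPt s atTop x := by
    obtain ⟨U, hU, hUs⟩ := mapClusterPt_iff_ultrafilter.1 hs
    exact mapClusterPt_iff_ultrafilter.2 ⟨U, hU, by simpa using hUs.add (hw0.mono_left hU)⟩
  have hxz := tendsto_of_euler_of_stable hg ha ha_lim ha_sum hxrec hB' hhx hD hDz hstable
    (hSD hsS) hsx
  simpa [hx] using hxz.sub hw0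

end KushnerClark

/-! ### Mean and second moment of the gradient estimate -/

section SingleStep

open scoped RealInnerProductSpace

variable {p : ℕ} {Ω : Type*} {m₀ : MeasurableSpace Ω} {μ : Measure Ω}

lemma rdsaGradEst_apply (L : EuclideanSpace ℝ (Fin p) → ℝ) (c : ℝ)
    (v : EuclideanSpace ℝ (Fin p)) (ep em : ℝ) (θ : EuclideanSpace ℝ (Fin p)) (l : Fin p) :
    rdsaGradEst L c v ep em θ l = (2 * c)⁻¹ *
      (v l * L (θ + c • v) - v l * L (θ - c • v) + (v l * ep - v l * em)) := by
  simp only [rdsaGradEst, PiLp.smul_apply, smul_eq_mul]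
  ring

lemma map_eq_stdGaussian [IsProbabilityMeasure μ] {π : Ω → EuclideanSpace ℝ (Fin p)}
    (hπ : iIndepFun (fun (i : Fin p) ω => π ω i) μ)
    (hlaw : ∀ i : Fin p, HasLaw (fun ω => π ω i) (gaussianReal 0 1) μ) :
    μ.map π = stdGaussian (EuclideanSpace ℝ (Fin p)) := by
  have h1 := (iIndepFun_iff_map_fun_eq_pi_map fun i => (hlaw i).aemeasurable).1 hπ
  simp_rw [(hlaw _).map_eq] at h1
  rw [← map_pi_eq_stdGaussian, ← h1, AEMeasurable.map_map_of_aemeasurable (by fun_prop)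
    (aemeasurable_pi_lambda _ fun i => (hlaw i).aemeasurable)]
  rfl

/-- The second moment of the gradient estimate is of order `c⁻²`. -/
lemma memLp_rdsaGradEst {L : EuclideanSpace ℝ (Fin p) → ℝ} (hL : Continuous L)
    {π θ : Ω → EuclideanSpace ℝ (Fin p)} {ep em : Ω → ℝ} (hπ : Measurable π) (hθ : Measurable θ)
    (hep : Measurable ep) (hem : Measurable em) {c α β : ℝ} (l : Fin p)
    (h1 : Integrable (fun ω => π ω l ^ 2 * L (θ ω + c • π ω) ^ 2) μ ∧
      ∫ ω, π ω l ^ 2 * L (θ ω + c • π ω) ^ 2 ∂μ ≤ α)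
    (h2 : Integrable (fun ω => π ω l ^ 2 * L (θ ω - c • π ω) ^ 2) μ ∧
      ∫ ω, π ω l ^ 2 * L (θ ω - c • π ω) ^ 2 ∂μ ≤ α)
    (h3 : Integrable (fun ω => π ω l ^ 2 * ep ω ^ 2) μ ∧ ∫ ω, π ω l ^ 2 * ep ω ^ 2 ∂μ ≤ β)
    (h4 : Integrable (fun ω => π ω l ^ 2 * em ω ^ 2) μ ∧ ∫ ω, π ω l ^ 2 * em ω ^ 2 ∂μ ≤ β) :
    MemLp (fun ω => rdsaGradEst L c (π ω) (ep ω) (em ω) (θ ω) l) 2 μ ∧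
      ∫ ω, (rdsaGradEst L c (π ω) (ep ω) (em ω) (θ ω) l) ^ 2 ∂μ ≤
        2 * (α + β) * (c⁻¹) ^ 2 := by
  have hLm := hL.measurable
  have hpt : ∀ ω, (rdsaGradEst L c (π ω) (ep ω) (em ω) (θ ω) l) ^ 2 ≤ (c⁻¹) ^ 2 *
      ((π ω l ^ 2 * L (θ ω + c • π ω) ^ 2 + π ω l ^ 2 * L (θ ω - c • π ω) ^ 2) +
        (π ω l ^ 2 * ep ω ^ 2 + π ω l ^ 2 * em ω ^ 2)) := fun ω => by
    have key : ∀ x y z w : ℝ, (x - y + (z - w)) ^ 2 ≤ 4 * (x ^ 2 + y ^ 2 + (z ^ 2 + w ^ 2)) := by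
      intro x y z w
      nlinarith [sq_nonneg (x + y), sq_nonneg (x - z), sq_nonneg (x + w),
        sq_nonneg (y + z), sq_nonneg (y - w), sq_nonneg (z + w)]
    rw [rdsaGradEst_apply, mul_pow, mul_inv, mul_pow]
    have := mul_le_mul_of_nonneg_left (key (π ω l * L (θ ω + c • π ω))
      (π ω l * L (θ ω - c • π ω)) (π ω l * ep ω) (π ω l * em ω)) (sq_nonneg (c⁻¹))
    simp only [mul_pow] at this
    linarith
  have hi12 : Integrable (fun ω => π ω l ^ 2 * L (θ ω + c • π ω) ^ 2 +
      π ω l ^ 2 * L (θ ω - c • π ω) ^ 2) μ := h1.1.add h2.1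
  have hi34 : Integrable (fun ω => π ω l ^ 2 * ep ω ^ 2 + π ω l ^ 2 * em ω ^ 2) μ :=
    h3.1.add h4.1
  have hbi : Integrable (fun ω => (c⁻¹) ^ 2 *
      ((π ω l ^ 2 * L (θ ω + c • π ω) ^ 2 + π ω l ^ 2 * L (θ ω - c • π ω) ^ 2) +
        (π ω l ^ 2 * ep ω ^ 2 + π ω l ^ 2 * em ω ^ 2))) μ := (hi12.add hi34).const_mul _
  have hm : Measurable fun ω => rdsaGradEst L c (π ω) (ep ω) (em ω) (θ ω) l := by
    simp_rw [rdsaGradEst_apply]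
    fun_prop
  have hsq : Integrable (fun ω => (rdsaGradEst L c (π ω) (ep ω) (em ω) (θ ω) l) ^ 2) μ :=
    hbi.mono' (hm.pow_const 2).aestronglyMeasurable (Eventually.of_forall fun ω => by
      rw [Real.norm_of_nonneg (sq_nonneg _)]
      exact hpt ω)
  refine ⟨(memLp_two_iff_integrable_sq hm.aestronglyMeasurable).2 hsq, ?_⟩
  refine (integral_mono hsq hbi hpt).trans ?_
  rw [integral_const_mul, integral_add hi12 hi34, integral_add h1.1 h2.1, integral_add h3.1 h4.1,
    mul_comm]
  refine mul_le_mul_of_nonneg_right ?_ (sq_nonneg _)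
  linarith [h1.2, h2.2, h3.2, h4.2]

/-- Given the past, which comprises the current iterate `φ (W ω)`, the gradient estimate has the
mean of the two smoothed gradients at the scales `c` and `-c`; the noise drops out since the
direction is independent of it and has mean zero. -/
lemma condExp_rdsaGradEst [IsProbabilityMeasure μ] {L : EuclideanSpace ℝ (Fin p) → ℝ}
    (hL : Continuous L) {γ : Type*} [mγ : MeasurableSpace γ] {W : Ω → γ} (hW : Measurable W)
    {π : Ω → EuclideanSpace ℝ (Fin p)} (hπ : Measurable π) (hind : IndepFun W π μ)
    (hlaw : μ.map π = stdGaussian (EuclideanSpace ℝ (Fin p)))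
    {φ : γ → EuclideanSpace ℝ (Fin p)} (hφ : Measurable φ) {ep em : γ → ℝ}
    (hep : Measurable ep) (hem : Measurable em) {m : MeasurableSpace Ω} (hm : m ≤ mγ.comap W)
    (hφm : Measurable[m] fun ω => φ (W ω)) {c : ℝ} (hc : c ≠ 0) (l : Fin p)
    (h1 : Integrable (fun ω => π ω l * L (φ (W ω) + c • π ω)) μ)
    (h2 : Integrable (fun ω => π ω l * L (φ (W ω) - c • π ω)) μ)
    (h3 : Integrable (fun ω => π ω l * ep (W ω)) μ)
    (h4 : Integrable (fun ω => π ω l * em (W ω)) μ) :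
    μ[fun ω => rdsaGradEst L c (π ω) (ep (W ω)) (em (W ω)) (φ (W ω)) l | m] =ᵐ[μ] fun ω =>
      (gaussianSmoothedGradient L (EuclideanSpace.single l 1) c (φ (W ω)) +
        gaussianSmoothedGradient L (EuclideanSpace.single l 1) (-c) (φ (W ω))) / 2 := by
  have hLm := hL.measurable
  have hle : mγ.comap W ≤ m₀ := hW.comap_le
  -- the conditional expectation of a function of `W` and the direction, by the tower property
  have tower : ∀ f : γ × EuclideanSpace ℝ (Fin p) → ℝ, Measurable f →
      Integrable (fun ω => f (W ω, π ω)) μ →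
      StronglyMeasurable[m] (fun ω => ∫ v, f (W ω, v) ∂(stdGaussian (EuclideanSpace ℝ (Fin p)))) →
      μ[fun ω => f (W ω, π ω) | m] =ᵐ[μ]
        fun ω => ∫ v, f (W ω, v) ∂(stdGaussian (EuclideanSpace ℝ (Fin p))) := by
    intro f hf hfi hfm
    have e1 := condExp_comap_ae_eq_integral_map_of_indepFun hW hπ hind hf.stronglyMeasurable hfi
    rw [hlaw] at e1
    have e2 := condExp_condExp_of_le (μ := μ) (f := fun ω => f (W ω, π ω)) hm hle
    have e3 := condExp_congr_ae (m := m) e1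
    have e4 := condExp_of_stronglyMeasurable (hm.trans hle) hfm (integrable_condExp.congr e1)
    rw [e4] at e3
    exact e2.symm.trans e3
  have hsm : ∀ b : ℝ, Measurable[m] fun ω => ∫ v : EuclideanSpace ℝ (Fin p),
      v l * L (φ (W ω) + b • v) ∂(stdGaussian (EuclideanSpace ℝ (Fin p))) := fun b => by
    have : StronglyMeasurable fun θ : EuclideanSpace ℝ (Fin p) =>
        ∫ v : EuclideanSpace ℝ (Fin p), v l * L (θ + b • v)
          ∂(stdGaussian (EuclideanSpace ℝ (Fin p))) :=
      StronglyMeasurable.integral_prod_right (Continuous.stronglyMeasurable (by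
        simp only [Function.uncurry_def]
        fun_prop))
    exact this.measurable.comp hφm
  have hS : ∀ b : ℝ, b ≠ 0 → ∀ θ, ∫ v : EuclideanSpace ℝ (Fin p), v l * L (θ + b • v)
      ∂(stdGaussian (EuclideanSpace ℝ (Fin p))) =
      b * gaussianSmoothedGradient L (EuclideanSpace.single l 1) b θ := fun b hb θ => by
    rw [gaussianSmoothedGradient, mul_inv_cancel_left₀ hb]
    refine integral_congr_ae (Eventually.of_forall fun v => ?_)
    simp [EuclideanSpace.inner_single_left, mul_comm]
  have hmean : ∫ v : EuclideanSpace ℝ (Fin p), v l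
      ∂(stdGaussian (EuclideanSpace ℝ (Fin p))) = 0 := by
    have := integral_inner_stdGaussian (EuclideanSpace.single l (1 : ℝ) : EuclideanSpace ℝ (Fin p))
    simpa [EuclideanSpace.inner_single_left] using this
  have t1 := tower (fun q => q.2 l * L (φ q.1 + c • q.2)) (by fun_prop) h1
    (hsm c).stronglyMeasurable
  have t2 := tower (fun q => q.2 l * L (φ q.1 + (-c) • q.2)) (by fun_prop)
    (by simpa [sub_eq_add_neg] using h2) (hsm (-c)).stronglyMeasurable
  have h3' : ∀ e : γ → ℝ, (fun ω => ∫ v : EuclideanSpace ℝ (Fin p), v l * e (W ω)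
      ∂(stdGaussian (EuclideanSpace ℝ (Fin p)))) = fun _ => 0 := fun e => by
    ext ω
    rw [integral_mul_const, hmean, zero_mul]
  have t3 := tower (fun q => q.2 l * ep q.1) (by fun_prop) h3
    (by simp only [h3']; exact stronglyMeasurable_const)
  have t4 := tower (fun q => q.2 l * em q.1) (by fun_prop) h4
    (by simp only [h3']; exact stronglyMeasurable_const)
  simp only [h3'] at t3 t4
  simp only [neg_smul, ← sub_eq_add_neg] at t2
  set A : Ω → ℝ := fun ω => π ω l * L (φ (W ω) + c • π ω)
  set B : Ω → ℝ := fun ω => π ω l * L (φ (W ω) - c • π ω)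
  set C : Ω → ℝ := fun ω => π ω l * ep (W ω)
  set D : Ω → ℝ := fun ω => π ω l * em (W ω)
  have e0 : (fun ω => rdsaGradEst L c (π ω) (ep (W ω)) (em (W ω)) (φ (W ω)) l) =
      (2 * c)⁻¹ • (A - B + (C - D)) := by
    ext ω
    rw [rdsaGradEst_apply]
    rfl
  rw [e0]
  filter_upwards [condExp_smul (μ := μ) (2 * c)⁻¹ (A - B + (C - D)) m,
    condExp_add (h1.sub h2) (h3.sub h4) m, condExp_sub h1 h2 m, condExp_sub h3 h4 m,
    t1, t2, t3, t4] with ω q0 q1 q2 q3 q4 q5 q6 q7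
  have q5' : (μ[B | m]) ω = -c * gaussianSmoothedGradient L (EuclideanSpace.single l 1) (-c)
      (φ (W ω)) := by
    rw [q5, ← hS (-c) (neg_ne_zero.2 hc)]
    simp only [neg_smul, ← sub_eq_add_neg]
  rw [q0, Pi.smul_apply, q1, Pi.add_apply, q2, q3, Pi.sub_apply, Pi.sub_apply, q4, q5', q6, q7,
    hS c hc, smul_eq_mul]
  field_simp
  ring

end SingleStep

/-! ### The iterates -/

section Iterates

variable {p : ℕ} {Ω : Type*} {m₀ : MeasurableSpace Ω} {μ : Measure Ω}

lemma measurable_rdsaIterate {L : EuclideanSpace ℝ (Fin p) → ℝ} (hL : Continuous L) {a c : ℕ → ℝ}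
    {π : ℕ → Ω → EuclideanSpace ℝ (Fin p)} {εp εm : ℕ → Ω → ℝ} {θ₀ : Ω → EuclideanSpace ℝ (Fin p)}
    (hπ : ∀ k, Measurable (π k)) (hεp : ∀ k, Measurable (εp k)) (hεm : ∀ k, Measurable (εm k))
    (hθ₀ : Measurable θ₀) (k : ℕ) : Measurable (rdsaIterate L a c π εp εm θ₀ k) := by
  have hLm := hL.measurable
  induction k with
  | zero => exact hθ₀
  | succ k ih =>
    have h1 := hπ k
    have h2 := hεp k
    have h3 := hεm k
    have e : rdsaIterate L a c π εp εm θ₀ (k + 1) = fun ω => rdsaIterate L a c π εp εm θ₀ k ω -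
        a k • rdsaGradEst L (c k) (π k ω) (εp k ω) (εm k ω)
          (rdsaIterate L a c π εp εm θ₀ k ω) := rfl
    rw [e]
    unfold rdsaGradEst
    fun_prop

/-- Second moment of the product of a direction component and an independent noise. -/
lemma integrable_and_integral_sq_mul_sq_le {X Y : Ω → ℝ} (hX : Measurable X) (hY : Measurable Y)
    (hXY : IndepFun X Y μ) (hX1 : ∫ ω, X ω * X ω ∂μ = 1) {α : ℝ}
    (hY1 : Integrable (fun ω => Y ω ^ 2) μ ∧ ∫ ω, Y ω ^ 2 ∂μ ≤ α) :
    Integrable (fun ω => X ω ^ 2 * Y ω ^ 2) μ ∧ ∫ ω, X ω ^ 2 * Y ω ^ 2 ∂μ ≤ α := by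
  have hind : IndepFun (fun ω => X ω ^ 2) (fun ω => Y ω ^ 2) μ :=
    hXY.comp (φ := fun x => x ^ 2) (ψ := fun x => x ^ 2) (by fun_prop) (by fun_prop)
  have hX2 : ∫ ω, X ω ^ 2 ∂μ = 1 := by simpa only [pow_two] using hX1
  have hXi : Integrable (fun ω => X ω ^ 2) μ := Integrable.of_integral_ne_zero (by simp [hX2])
  refine ⟨hind.integrable_mul hXi hY1.1, ?_⟩
  rw [hind.integral_fun_mul_eq_mul_integral (hX.pow_const 2).aestronglyMeasurable
    (hY.pow_const 2).aestronglyMeasurable, hX2, one_mul]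
  exact hY1.2

/-- By Fubini's theorem, the moment bounds of a single step with a standard Gaussian direction
give a center at which `L` has a Gaussian-weighted second moment. -/
lemma exists_integrable_sq_stdGaussian [IsProbabilityMeasure μ]
    {L : EuclideanSpace ℝ (Fin p) → ℝ} (hL : Continuous L)
    {π θ : Ω → EuclideanSpace ℝ (Fin p)} (hπ : Measurable π) (hθ : Measurable θ)
    (hind : IndepFun θ π μ) (hlaw : μ.map π = stdGaussian (EuclideanSpace ℝ (Fin p))) {c : ℝ}
    (hint : ∀ l : Fin p, Integrable (fun ω => π ω l ^ 2 * L (θ ω + c • π ω) ^ 2) μ) :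
    ∃ z, Integrable (fun v => ‖v‖ ^ 2 * L (z + c • v) ^ 2)
      (stdGaussian (EuclideanSpace ℝ (Fin p))) := by
  have h1 : Integrable (fun ω => ‖π ω‖ ^ 2 * L (θ ω + c • π ω) ^ 2) μ := by
    simp_rw [EuclideanSpace.real_norm_sq_eq, Finset.sum_mul]
    exact integrable_finsetSum _ fun l _ => hint l
  have h2 : Integrable (fun q : EuclideanSpace ℝ (Fin p) × EuclideanSpace ℝ (Fin p) =>
      ‖q.2‖ ^ 2 * L (q.1 + c • q.2) ^ 2) ((μ.map θ).prod (stdGaussian _)) := by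
    rw [← hlaw, ← (indepFun_iff_map_prod_eq_prod_map_map hθ.aemeasurable hπ.aemeasurable).1 hind]
    exact (integrable_map_measure (Continuous.aestronglyMeasurable (by fun_prop))
      (hθ.prodMk hπ).aemeasurable).2 h1
  have : IsProbabilityMeasure (μ.map θ) := Measure.isProbabilityMeasure_map hθ.aemeasurable
  exact h2.prod_right_ae.exists

end Iterates

theorem mainTheorem2 {p : ℕ} {Ω : Type*} [MeasurableSpace Ω] (μ : Measure Ω)
    [IsProbabilityMeasure μ]
    -- the loss function and its minimizer
    (L : EuclideanSpace ℝ (Fin p) → ℝ) (hL : ContDiff ℝ 1 L)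
    (θs : EuclideanSpace ℝ (Fin p)) (hmin : ∀ θ, L θs ≤ L θ)
    -- gains, directions, noise, starting point; `θh` are the iterates
    (a c : ℕ → ℝ) (π : ℕ → Ω → EuclideanSpace ℝ (Fin p)) (εp εm : ℕ → Ω → ℝ)
    (θ₀ : Ω → EuclideanSpace ℝ (Fin p)) (θh : ℕ → Ω → EuclideanSpace ℝ (Fin p))
    (hπ_meas : ∀ k, Measurable (π k)) (hεp_meas : ∀ k, Measurable (εp k))
    (hεm_meas : ∀ k, Measurable (εm k)) (hθ₀_meas : Measurable θ₀)
    (hθh : θh = rdsaIterate L a c π εp εm θ₀)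
    (K : ℕ) (α₀ α₁ α₂ : ℝ)
    -- the noise has mean zero and is independent of the current iterate and direction
    (hε_mean : ∀ k ≥ K, ∫ ω, εp k ω ∂μ = 0 ∧ ∫ ω, εm k ω ∂μ = 0)
    (hε_indep : ∀ k ≥ K, IndepFun (fun ω => (εp k ω, εm k ω)) (fun ω => (θh k ω, π k ω)) μ)
    -- the direction is drawn independently of the iterates so far and of the current noise
    (hπ_indep : ∀ k ≥ K, IndepFun (π k)
      (fun ω => ((fun i : Fin (k + 1) => θh i ω), (εp k ω, εm k ω))) μ)
    -- continuous third derivatives, with entries bounded by `α₂`, near the iterates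
    (hL3 : ∀ k ≥ K, ∀ᵐ ω ∂μ, ∀ᶠ θ in 𝓝 (θh k ω), ContDiffAt ℝ 3 L θ ∧
      ∀ i j l : Fin p, |iteratedFDeriv ℝ 3 L θ ![EuclideanSpace.single i 1,
        EuclideanSpace.single j 1, EuclideanSpace.single l 1]| ≤ α₂)
    -- A1
    (ha_pos : ∀ k, 0 < a k) (hc_pos : ∀ k, 0 < c k)
    (ha_lim : Tendsto a atTop (𝓝 0)) (hc_lim : Tendsto c atTop (𝓝 0))
    (ha_sum : Tendsto (fun n => ∑ k ∈ Finset.range n, a k) atTop atTop)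
    (hac_sum : Summable fun k => (a k / c k) ^ 2)
    -- A2
    (hbdd : ∀ᵐ ω ∂μ, ∃ C : ℝ, ∀ k, ‖θh k ω‖ ≤ C)
    -- A3
    (hstable : IsAsymptoticallyStable L θs)
    -- A4
    (hrec : ∃ S : Set (EuclideanSpace ℝ (Fin p)), IsCompact S ∧ S ⊆ domainOfAttraction L θs ∧
      ∀ᵐ ω ∂μ, ∃ᶠ k in atTop, θh k ω ∈ S)
    -- A5
    (hεp_mom : ∀ k ≥ K, Integrable (fun ω => εp k ω ^ 2) μ ∧ ∫ ω, εp k ω ^ 2 ∂μ ≤ α₀)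
    (hεm_mom : ∀ k ≥ K, Integrable (fun ω => εm k ω ^ 2) μ ∧ ∫ ω, εm k ω ^ 2 ∂μ ≤ α₀)
    (hπ_cov : ∀ k ≥ K, ∀ i j : Fin p, ∫ ω, π k ω i * π k ω j ∂μ = if i = j then 1 else 0)
    (hLp_mom : ∀ k ≥ K, ∀ l : Fin p,
      Integrable (fun ω => π k ω l ^ 2 * L (θh k ω + c k • π k ω) ^ 2) μ ∧
        ∫ ω, π k ω l ^ 2 * L (θh k ω + c k • π k ω) ^ 2 ∂μ ≤ α₁)
    (hLm_mom : ∀ k ≥ K, ∀ l : Fin p,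
      Integrable (fun ω => π k ω l ^ 2 * L (θh k ω - c k • π k ω) ^ 2) μ ∧
        ∫ ω, π k ω l ^ 2 * L (θh k ω - c k • π k ω) ^ 2 ∂μ ≤ α₁)
    -- the components of each direction are independent standard normal variables
    (hπ_iid : ∀ k ≥ K, iIndepFun (fun (i : Fin p) ω => π k ω i) μ)
    (hπ_gauss : ∀ k ≥ K, ∀ i : Fin p, HasLaw (fun ω => π k ω i) (gaussianReal 0 1) μ) :
    ∀ᵐ ω ∂μ, Tendsto (fun k => θh k ω) atTop (𝓝 θs) := by
  have hLc : Continuous L := hL.continuous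
  have hθm : ∀ k, Measurable (θh k) := fun k => by
    rw [hθh]
    exact measurable_rdsaIterate hLc hπ_meas hεp_meas hεm_meas hθ₀_meas k
  have hstep : ∀ k ω, θh (k + 1) ω = θh k ω -
      a k • rdsaGradEst L (c k) (π k ω) (εp k ω) (εm k ω) (θh k ω) := fun k ω => by
    rw [hθh]
    rfl
  have hlaw : ∀ k ≥ K, μ.map (π k) = stdGaussian (EuclideanSpace ℝ (Fin p)) := fun k hk =>
    map_eq_stdGaussian (hπ_iid k hk) (hπ_gauss k hk)
  -- the past of step `k` together with the noise of that step
  set W : (k : ℕ) → Ω → (Fin (k + 1) → EuclideanSpace ℝ (Fin p)) × (ℝ × ℝ) :=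
    fun k ω => (fun i : Fin (k + 1) => θh i ω, (εp k ω, εm k ω)) with hW
  have hWm : ∀ k, Measurable (W k) := fun k =>
    (measurable_pi_lambda (fun ω (i : Fin (k + 1)) => θh i ω) fun i => hθm i).prodMk
      ((hεp_meas k).prodMk (hεm_meas k))
  have hindW : ∀ k ≥ K, IndepFun (W k) (π k) μ := fun k hk => (hπ_indep k hk).symm
  have hind_p : ∀ k ≥ K, ∀ l, IndepFun (fun ω => π k ω l) (εp k) μ := fun k hk l =>
    (hπ_indep k hk).comp (φ := fun v : EuclideanSpace ℝ (Fin p) => v l)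
      (ψ := fun q : (Fin (k + 1) → EuclideanSpace ℝ (Fin p)) × (ℝ × ℝ) => q.2.1)
      (by fun_prop) (by fun_prop)
  have hind_m : ∀ k ≥ K, ∀ l, IndepFun (fun ω => π k ω l) (εm k) μ := fun k hk l =>
    (hπ_indep k hk).comp (φ := fun v : EuclideanSpace ℝ (Fin p) => v l)
      (ψ := fun q : (Fin (k + 1) → EuclideanSpace ℝ (Fin p)) × (ℝ × ℝ) => q.2.2)
      (by fun_prop) (by fun_prop)
  set ℱ : Filtration ℕ ‹MeasurableSpace Ω› :=
    Filtration.natural θh fun k => (hθm k).stronglyMeasurable with hℱ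
  have hθℱ : ∀ k, Measurable[ℱ k] (θh k) := fun k =>
    (Filtration.stronglyAdapted_natural fun k => (hθm k).stronglyMeasurable) k |>.measurable
  have hℱW : ∀ k, ℱ k ≤ MeasurableSpace.comap (W k) inferInstance := fun k => by
    refine iSup₂_le fun j hj => ?_
    have e : θh j = (fun q : (Fin (k + 1) → EuclideanSpace ℝ (Fin p)) × (ℝ × ℝ) =>
        q.1 ⟨j, Nat.lt_succ_of_le hj⟩) ∘ W k := rfl
    rw [e, ← MeasurableSpace.comap_comp]
    exact MeasurableSpace.comap_mono (Measurable.comap_le (by fun_prop))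
  set G : ℕ → Fin p → Ω → ℝ := fun k l ω =>
    rdsaGradEst L (c k) (π k ω) (εp k ω) (εm k ω) (θh k ω) l with hG
  have hnoise_p := fun k (hk : K ≤ k) (l : Fin p) => integrable_and_integral_sq_mul_sq_le
    (X := fun ω => π k ω l) (by have := hπ_meas k; fun_prop) (hεp_meas k) (hind_p k hk l)
    (by simpa using hπ_cov k hk l l) (hεp_mom k hk)
  have hnoise_m := fun k (hk : K ≤ k) (l : Fin p) => integrable_and_integral_sq_mul_sq_le
    (X := fun ω => π k ω l) (by have := hπ_meas k; fun_prop) (hεm_meas k) (hind_m k hk l)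
    (by simpa using hπ_cov k hk l l) (hεm_mom k hk)
  have hGmom : ∀ k ≥ K, ∀ l, MemLp (G k l) 2 μ ∧
      ∫ ω, G k l ω ^ 2 ∂μ ≤ 2 * (α₁ + α₀) * ((c k)⁻¹) ^ 2 := fun k hk l =>
    memLp_rdsaGradEst hLc (hπ_meas k) (hθm k) (hεp_meas k) (hεm_meas k) l (hLp_mom k hk l)
      (hLm_mom k hk l) (hnoise_p k hk l) (hnoise_m k hk l)
  -- the conditional mean of the gradient estimate
  have hGc : ∀ k ≥ K, ∀ l, μ[G k l | ℱ k] =ᵐ[μ] fun ω =>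
      (gaussianSmoothedGradient L (EuclideanSpace.single l 1) (c k) (θh k ω) +
        gaussianSmoothedGradient L (EuclideanSpace.single l 1) (-c k) (θh k ω)) / 2 := by
    intro k hk l
    have h1 := hπ_meas k
    have h2 := hθm k
    have h3 := hεp_meas k
    have h4 := hεm_meas k
    have h5 := hLc.measurable
    have hi : ∀ f : Ω → ℝ, Measurable f → Integrable (fun ω => π k ω l ^ 2 * f ω ^ 2) μ →
        Integrable (fun ω => π k ω l * f ω) μ := fun f hf hfi => by
      refine MemLp.integrable one_le_two ((memLp_two_iff_integrable_sq
        (Measurable.aestronglyMeasurable (by fun_prop))).2 ?_)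
      simpa only [mul_pow] using hfi
    exact condExp_rdsaGradEst hLc (hWm k) h1 (hindW k hk) (hlaw k hk)
      (φ := fun q => q.1 (Fin.last k)) (ep := fun q => q.2.1) (em := fun q => q.2.2)
      (by fun_prop) (by fun_prop) (by fun_prop) (hℱW k) (hθℱ k) (hc_pos k).ne' l
      (hi (fun ω => L (θh k ω + c k • π k ω)) (by fun_prop) (hLp_mom k hk l).1)
      (hi (fun ω => L (θh k ω - c k • π k ω)) (by fun_prop) (hLm_mom k hk l).1)
      (hi _ h3 (hnoise_p k hk l).1) (hi _ h4 (hnoise_m k hk l).1)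
  -- the increments of the iterates from the index `K` on
  set X : Fin p → ℕ → Ω → ℝ := fun l k => if K ≤ k then a k • G k l else 0 with hX
  have hXm : ∀ l k, StronglyMeasurable[ℱ (k + 1)] (X l k) := fun l k => by
    by_cases hk : K ≤ k
    · have e : X l k = fun ω => θh k ω l - θh (k + 1) ω l := by
        ext ω
        simp [hX, hk, hG, hstep]
      rw [e]
      have h1 : Measurable[ℱ (k + 1)] (θh k) := (hθℱ k).mono (ℱ.mono (Nat.le_succ k)) le_rfl
      have h2 := hθℱ (k + 1)
      refine Measurable.stronglyMeasurable ?_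
      fun_prop
    · simp only [hX, if_neg hk]
      exact stronglyMeasurable_zero
  have hX2 : ∀ l k, MemLp (X l k) 2 μ := fun l k => by
    by_cases hk : K ≤ k
    · simp only [hX, if_pos hk]
      exact (hGmom k hk l).1.const_smul _
    · simp only [hX, if_neg hk]
      exact MemLp.zero
  have hXsum : ∀ l, Summable fun k => ∫ ω, X l k ω ^ 2 ∂μ := fun l => by
    refine Summable.of_norm_bounded_eventually_nat (hac_sum.mul_left (2 * (α₁ + α₀))) ?_
    filter_upwards [eventually_ge_atTop K] with k hk
    rw [Real.norm_of_nonneg (integral_nonneg fun ω => sq_nonneg _)]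
    simp only [hX, if_pos hk, Pi.smul_apply, smul_eq_mul, mul_pow]
    rw [integral_const_mul]
    calc a k ^ 2 * ∫ ω, G k l ω ^ 2 ∂μ
        ≤ a k ^ 2 * (2 * (α₁ + α₀) * ((c k)⁻¹) ^ 2) :=
          mul_le_mul_of_nonneg_left (hGmom k hk l).2 (sq_nonneg _)
      _ = 2 * (α₁ + α₀) * (a k / c k) ^ 2 := by ring
  have hmart : ∀ l, ∀ᵐ ω ∂μ, ∃ s, Tendsto (fun n => ∑ k ∈ Finset.range n,
      (X l k ω - (μ[X l k | ℱ k]) ω)) atTop (𝓝 s) := fun l =>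
    ae_exists_tendsto_sum_sub_condExp (hXm l) (hX2 l) (hXsum l)
  have hXc : ∀ l k, K ≤ k → ∀ᵐ ω ∂μ, (μ[X l k | ℱ k]) ω = a k *
      ((gaussianSmoothedGradient L (EuclideanSpace.single l 1) (c k) (θh k ω) +
        gaussianSmoothedGradient L (EuclideanSpace.single l 1) (-c k) (θh k ω)) / 2) := by
    intro l k hk
    simp only [hX, if_pos hk]
    filter_upwards [condExp_smul (μ := μ) (a k) (G k l) (ℱ k), hGc k hk l] with ω h1 h2
    rw [h1, Pi.smul_apply, h2, smul_eq_mul]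
  -- a center with a Gaussian-weighted second moment of `L`
  obtain ⟨z, hz⟩ := exists_integrable_sq_stdGaussian hLc (hπ_meas K) (hθm K)
    ((hindW K le_rfl).comp
      (φ := fun q : (Fin (K + 1) → EuclideanSpace ℝ (Fin p)) × (ℝ × ℝ) => q.1 (Fin.last K))
      (by fun_prop) measurable_id)
    (hlaw K le_rfl) fun l => (hLp_mom K le_rfl l).1
  have hbias : ∀ l (R η : ℝ), 0 < η → ∃ c₁ > 0, ∀ θ : EuclideanSpace ℝ (Fin p), ‖θ‖ ≤ R →
      ∀ b : ℝ, 0 < |b| → |b| < c₁ →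
      |gaussianSmoothedGradient L (EuclideanSpace.single l 1) b θ - gradient L θ l| ≤ η := by
    intro l R η hη
    have := exists_gaussian_smoothing_sub_gradient_le hL (hc_pos K) hz
      (u := EuclideanSpace.single l 1) (by simp) R hη
    simpa only [EuclideanSpace.inner_single_left, map_one, one_mul] using this
  have hgc : Continuous (gradient L) :=
    (InnerProductSpace.toDual ℝ (EuclideanSpace ℝ (Fin p))).symm.continuous.comp
      (hL.continuous_fderiv (by simp))
  obtain ⟨S, hS, hSD, hrecS⟩ := hrec
  have hXc' : ∀ᵐ ω ∂μ, ∀ l k, K ≤ k → (μ[X l k | ℱ k]) ω = a k *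
      ((gaussianSmoothedGradient L (EuclideanSpace.single l 1) (c k) (θh k ω) +
        gaussianSmoothedGradient L (EuclideanSpace.single l 1) (-c k) (θh k ω)) / 2) := by
    rw [ae_all_iff]
    intro l
    rw [ae_all_iff]
    intro k
    by_cases hk : K ≤ k
    · filter_upwards [hXc l k hk] with ω hω _ using hω
    · exact Eventually.of_forall fun ω h => absurd h hk
  filter_upwards [hbdd, hrecS, ae_all_iff.2 hmart, hXc'] with ω ⟨C, hC⟩ hrecω hmartω hcω
  choose s hs using hmartω
  set h : ℕ → EuclideanSpace ℝ (Fin p) := fun k => WithLp.toLp 2 fun l =>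
    (gaussianSmoothedGradient L (EuclideanSpace.single l 1) (c k) (θh k ω) +
      gaussianSmoothedGradient L (EuclideanSpace.single l 1) (-c k) (θh k ω)) / 2 with hh
  set d : ℕ → EuclideanSpace ℝ (Fin p) := fun k => WithLp.toLp 2 fun l =>
    X l k ω - (μ[X l k | ℱ k]) ω with hd
  have hlim : ∀ {u : ℕ → EuclideanSpace ℝ (Fin p)} {v : EuclideanSpace ℝ (Fin p)},
      (∀ l, Tendsto (fun n => u n l) atTop (𝓝 (v l))) →
      Tendsto u atTop (𝓝 v) := fun {u v} huv =>
    ((PiLp.continuous_toLp 2 _).tendsto (WithLp.ofLp v)).comp (tendsto_pi_nhds.2 huv)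
  refine tendsto_of_stochastic_approximation (g := gradient L) (h := h) (d := d) (N := K)
    (l := WithLp.toLp 2 s) (D := domainOfAttraction L θs) hgc ha_pos ha_lim ha_sum ?_ hC ?_ ?_
    (fun y hy hy0 => hy0.2 y hy rfl) hstable.attractive ?_ hS hSD hrecω
  · intro k hk
    ext l
    simp only [hstep, hd, hh, PiLp.sub_apply, PiLp.smul_apply, smul_eq_mul, hcω l k hk]
    simp only [hX, if_pos hk, hG, Pi.smul_apply, smul_eq_mul]
    ring
  · refine hlim fun l => ?_
    rw [Metric.tendsto_atTop]
    intro ε hε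
    obtain ⟨c₁, hc₁, hb⟩ := hbias l C (ε / 2) (by linarith)
    obtain ⟨n₀, hn₀⟩ := Metric.tendsto_atTop.1 hc_lim c₁ hc₁
    refine ⟨n₀, fun k hk => ?_⟩
    have h1 := hn₀ k hk
    rw [dist_zero_right, Real.norm_eq_abs] at h1
    have h0 : 0 < |c k| := abs_pos.2 (hc_pos k).ne'
    have h2 := abs_le.1 (hb _ (hC k) (c k) h0 h1)
    have h3 := abs_le.1 (hb _ (hC k) (-c k) (by rwa [abs_neg]) (by rwa [abs_neg]))
    rw [Real.dist_eq]
    simp only [hh, PiLp.sub_apply, PiLp.zero_apply, sub_zero]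
    rw [abs_lt]
    constructor <;> linarith [h2.1, h2.2, h3.1, h3.2]
  · refine hlim fun l => ?_
    simpa [hd] using hs l
  · intro ε hε
    obtain ⟨δ, hδ, hδs⟩ := hstable.stable ε hε
    refine ⟨δ, hδ, fun y hy hy0 t ht => hδs (t + 1) y (fun r hr => ?_) hy0 t ⟨ht, by linarith⟩⟩
    exact (hy r hr.1).mono Ico_subset_Ici_self
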